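/- **Setting.** Let $n_1\le n_2$, $m\ge 0$, $k\ge 1$ be integers. For $x\in\mathbb R^{n}$ let $\|x\|_0$ be the number of nonzero entries and let $x^k$ be the restriction of $x$ to its $k$ entries of largest absolute value (ties broken arbitrarily). For $X\in\mathbb R^{n_1\times n_2}$ with singular values $\sigma_1(X)\ge\dots\ge\sigma_{n_1}(X)$ let $\|X\|_\star=\sum_i\sigma_i(X)$, let $\|X\|_F$ be the Frobenius norm, and let $X^k$ be the sum of the first $k$ terms of a (any) singular value decomposition of $X$. The restricted isometry constant $\delta_k$ of $A\in\mathbb R^{m\times n}$ is the smallest $\delta\ge 0$ with $(1-\delta)\|x\|_2^2\le\|Ax\|_2^2\le(1+\delta)\|x\|_2^2$ for all $x$ with $\|x\|_0\le k$; the restricted orthogonality constant $\theta_{k,k'}$ is the smallest $\theta\ge0$ with $|\langle Ax,Ax'\rangle|\le\theta\|x\|_2\|x'\|_2$ for all $x,x'$ with disjoint supports, $\|x\|_0\le k$, $\|x'\|_0\le k'$. For a linear operator $\mathcal A:\mathbb R^{n_1\times n_2}\to\mathbb R^m$ they are defined in the same way, with matrices $X$ of rank at most $k$ instead of $k$-sparse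 vectors, $\|\cdot\|_F$ instead of $\|\cdot\|_2$, and, for $\theta_{k,k'}$, pairs $X,X'$ of rank at most $k$ and $k'$ with orthogonal column spaces and orthogonal row spaces. An *RIP inequality* is an inequality $f(\delta_{i_1},\dots,\delta_{i_p},\theta_{j_1,j_1'},\dots,\theta_{j_q,j_q'})\le c$ with $c\ge0$ and a function $f$ that is nondecreasing in its nonnegative arguments and satisfies $f(0,\dots,0)=0$. For a noise level $\varepsilon$ and measurements $y$, a vector $x^*$ is *as good as* $x_0$ if $\|Ax^*-y\|_2\le\varepsilon$ and $\|x^*\|_1\le\|x_0\|_1$; a matrix $X^*$ is *as good as* $X_0$ if $\|\mathcal A(X^*)-y\|_2\le\varepsilon$ and $\|X^*\|_\star\le\|X_0\|_\star$. **Lemma.** (a) Let $\mathcal F$ be a set of RIP inequalities, $\varepsilon, C_1,C_2,C_3\in\mathbb R$. (i) Suppose that for every $A\in\mathbb R^{m\times n_1}$ satisfying $\mathcal F$, all $x_0$, all $z$ with $\|z\|_2\le\varepsilon$, and all $x^*$ as good as $x_0$ with respect to $y=Ax_0+z$, $$\|x_0-x^*\|_2\le\frac{C_1}{\sqrt k}\|x_0-x_0^k\|_1+C_2\varepsilon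 .$$ Then for every $\mathcal A:\mathbb R^{n_1\times n_2}\to\mathbb R^m$ satisfying $\mathcal F$, all $X_0$, all $z$ with $\|z\|_2\le\varepsilon$, and all $X^*$ as good as $X_0$ with respect to $y=\mathcal A(X_0)+z$, $$\|X_0-X^*\|_F\le\frac{C_1}{\sqrt k}\|X_0-X_0^k\|_\star+C_2\varepsilon .$$ (ii) In the same way, at the same noise level $\varepsilon$, if $\mathcal F$ guarantees $\|x_0-x^*\|_1\le C_3\|x_0-x_0^k\|_1$ for vectors, then it guarantees $\|X_0-X^*\|_\star\le C_3\|X_0-X_0^k\|_\star$ for matrices. (Apart from degenerate cases such a bound is possible only in the noiseless case $\varepsilon=0$.) (b) There are absolute constants $C_1,C_2,C_3>0$ such that for all $m$, $n_1\le n_2$, $k\ge1$ and every $\mathcal A:\mathbb R^{n_1\times n_2}\to\mathbb R^m$ with $\delta_{2k}<0.472$, or with $k\ge2$ and $\delta_k<0.307$: for all $\varepsilon$, $X_0$, all $z$ with $\|z\|_2\le\varepsilon$ and all $X^*$ as good as $X_0$ with respect to $y=\mathcal A(X_0)+z$, $$\|X_0-X^*\|_F\le\frac{C_1}{\sqrt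 k}\|X_0-X_0^k\|_\star+C_2\varepsilon ,$$ and, if $\varepsilon=0$, also $\|X_0-X^*\|_\star\le C_3\|X_0-X_0^k\|_\star$. -/

import Mathlib

namespace LowRank

noncomputable section

/-- The vector space `ℝⁿ` with its Euclidean norm. -/
abbrev Vec (n : ℕ) : Type := EuclideanSpace ℝ (Fin n)

/-- A linear measurement operator `ℝ^{n₁ × n₂} → ℝᵐ`. -/
abbrev MeasOp (m n₁ n₂ : ℕ) : Type := Matrix (Fin n₁) (Fin n₂) ℝ →ₗ[ℝ] Vec m

/-! ### Vectors -/

/-- The number `‖x‖₀` of nonzero entries. -/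
def nnzCount {n : ℕ} (x : Vec n) : ℕ := (Finset.univ.filter fun i => x i ≠ 0).card

/-- The `ℓ₁` norm. -/
def l1Norm {n : ℕ} (x : Vec n) : ℝ := ∑ i, |x i|

/-- `y` is the restriction of `x` to its `k` entries of largest absolute value (to all entries if
`k ≥ n`). If there are ties, every way of breaking them is admitted. -/
def IsTopRestriction {n : ℕ} (x : Vec n) (k : ℕ) (y : Vec n) : Prop :=
  ∃ S : Finset (Fin n), S.card = min k n ∧ (∀ i ∈ S, ∀ j ∉ S, |x j| ≤ |x i|) ∧
    ∀ i, y i = if i ∈ S then x i else 0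

/-- `x'` is as good as `x₀` with respect to the measurements `y` and the noise level `ε`. -/
def VecAsGood {m n : ℕ} (A : Matrix (Fin m) (Fin n) ℝ) (ε : ℝ) (y : Vec m) (x₀ x' : Vec n) :
    Prop :=
  ‖A.toEuclideanLin x' - y‖ ≤ ε ∧ l1Norm x' ≤ l1Norm x₀

/-! ### Matrices -/

/-- The `i`-th largest singular value (indices start at `0`). -/
def sigma {n₁ n₂ : ℕ} (X : Matrix (Fin n₁) (Fin n₂) ℝ) (i : ℕ) : ℝ :=
  X.toEuclideanLin.singularValues i

/-- The nuclear norm; it is used for `n₁ ≤ n₂` only, where there are `n₁` singular values. -/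
def nuclearNorm {n₁ n₂ : ℕ} (X : Matrix (Fin n₁) (Fin n₂) ℝ) : ℝ :=
  ∑ i : Fin n₁, sigma X i

/-- The Frobenius norm. -/
def frobNorm {n₁ n₂ : ℕ} (X : Matrix (Fin n₁) (Fin n₂) ℝ) : ℝ :=
  Real.sqrt (∑ i, ∑ j, X i j ^ 2)

/-- `(U, V)` is a unitary pair. -/
def IsUnitaryPair {n₁ n₂ : ℕ} (U : Matrix (Fin n₁) (Fin n₁) ℝ) (V : Matrix (Fin n₂) (Fin n₁) ℝ) :
    Prop :=
  U.transpose * U = 1 ∧ U * U.transpose = 1 ∧ V.transpose * V = 1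

/-- `Y` is obtained by keeping the first `k` terms of a singular value decomposition of `X`.
All decompositions are admitted. -/
def IsSVDTruncation {n₁ n₂ : ℕ} (X : Matrix (Fin n₁) (Fin n₂) ℝ) (k : ℕ)
    (Y : Matrix (Fin n₁) (Fin n₂) ℝ) : Prop :=
  ∃ (U : Matrix (Fin n₁) (Fin n₁) ℝ) (V : Matrix (Fin n₂) (Fin n₁) ℝ), IsUnitaryPair U V ∧
    X = U * Matrix.diagonal (fun i : Fin n₁ => sigma X i) * V.transpose ∧
    Y = U * Matrix.diagonal (fun i : Fin n₁ => if (i : ℕ) < k then sigma X i else 0) *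
      V.transpose

/-- `X'` is as good as `X₀` with respect to the measurements `y` and the noise level `ε`. -/
def MatAsGood {m n₁ n₂ : ℕ} (𝒜 : MeasOp m n₁ n₂) (ε : ℝ) (y : Vec m)
    (X₀ X' : Matrix (Fin n₁) (Fin n₂) ℝ) : Prop :=
  ‖𝒜 X' - y‖ ≤ ε ∧ nuclearNorm X' ≤ nuclearNorm X₀

/-! ### Restricted isometry and restricted orthogonality constants

In each case the infimum is over a nonempty closed set of nonnegative reals, so it is the smallest
admissible constant. -/

/-- The restricted isometry constant `δ_k` of a matrix acting on vectors. -/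
def vecRIC {m n : ℕ} (A : Matrix (Fin m) (Fin n) ℝ) (k : ℕ) : ℝ :=
  sInf {δ : ℝ | 0 ≤ δ ∧ ∀ x : Vec n, nnzCount x ≤ k →
    (1 - δ) * ‖x‖ ^ 2 ≤ ‖A.toEuclideanLin x‖ ^ 2 ∧
    ‖A.toEuclideanLin x‖ ^ 2 ≤ (1 + δ) * ‖x‖ ^ 2}

/-- The restricted isometry constant `δ_k` of an operator acting on matrices. -/
def opRIC {m n₁ n₂ : ℕ} (𝒜 : MeasOp m n₁ n₂) (k : ℕ) : ℝ :=
  sInf {δ : ℝ | 0 ≤ δ ∧ ∀ X : Matrix (Fin n₁) (Fin n₂) ℝ, X.rank ≤ k →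
    (1 - δ) * frobNorm X ^ 2 ≤ ‖𝒜 X‖ ^ 2 ∧ ‖𝒜 X‖ ^ 2 ≤ (1 + δ) * frobNorm X ^ 2}

/-- The restricted orthogonality constant `θ_{k,k'}` of a matrix acting on vectors. -/
def vecROC {m n : ℕ} (A : Matrix (Fin m) (Fin n) ℝ) (k k' : ℕ) : ℝ :=
  sInf {θ : ℝ | 0 ≤ θ ∧ ∀ x x' : Vec n, nnzCount x ≤ k → nnzCount x' ≤ k' →
    (∀ i, x i = 0 ∨ x' i = 0) →
    |inner ℝ (A.toEuclideanLin x) (A.toEuclideanLin x')| ≤ θ * ‖x‖ * ‖x'‖}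

/-- The restricted orthogonality constant `θ_{k,k'}` of an operator acting on matrices: the two
matrices have orthogonal column spaces (`Xᵀ X' = 0`) and orthogonal row spaces (`X X'ᵀ = 0`). -/
def opROC {m n₁ n₂ : ℕ} (𝒜 : MeasOp m n₁ n₂) (k k' : ℕ) : ℝ :=
  sInf {θ : ℝ | 0 ≤ θ ∧ ∀ X X' : Matrix (Fin n₁) (Fin n₂) ℝ, X.rank ≤ k → X'.rank ≤ k' →
    X.transpose * X' = 0 → X * X'.transpose = 0 →
    |inner ℝ (𝒜 X) (𝒜 X')| ≤ θ * frobNorm X * frobNorm X'}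

/-- An RIP inequality `f (δ_{i₁}, …, δ_{i_p}, θ_{j₁,j₁'}, …, θ_{j_q,j_q'}) ≤ c`: here `c ≥ 0`, and
`f` is increasing (in the weak sense) in its nonnegative arguments and vanishes at the origin. -/
structure RIPInequality where
  p : ℕ
  q : ℕ
  ricIndex : Fin p → ℕ
  rocIndex : Fin q → ℕ × ℕ
  f : (Fin p → ℝ) → (Fin q → ℝ) → ℝ
  c : ℝ
  mono : ∀ δ δ' θ θ', 0 ≤ δ → δ ≤ δ' → 0 ≤ θ → θ ≤ θ' → f δ θ ≤ f δ' θ'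
  map_zero : f 0 0 = 0
  c_nonneg : 0 ≤ c

/-- The matrix `A` satisfies all the RIP inequalities in `F`. -/
def VecSatisfies {m n : ℕ} (F : Set RIPInequality) (A : Matrix (Fin m) (Fin n) ℝ) : Prop :=
  ∀ I ∈ F, I.f (fun s => vecRIC A (I.ricIndex s))
    (fun s => vecROC A (I.rocIndex s).1 (I.rocIndex s).2) ≤ I.c

/-- The operator `𝒜` satisfies all the RIP inequalities in `F`. -/
def OpSatisfies {m n₁ n₂ : ℕ} (F : Set RIPInequality) (𝒜 : MeasOp m n₁ n₂) : Prop :=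
  ∀ I ∈ F, I.f (fun s => opRIC 𝒜 (I.ricIndex s))
    (fun s => opROC 𝒜 (I.rocIndex s).1 (I.rocIndex s).2) ≤ I.c

/-! ### Robust recovery -/

/-- Robust recovery of vectors in the `ℓ₂` norm at noise level `ε`. -/
def VecL2Robust {m n : ℕ} (A : Matrix (Fin m) (Fin n) ℝ) (k : ℕ) (ε C₁ C₂ : ℝ) : Prop :=
  ∀ (x₀ x' xk : Vec n) (z : Vec m), ‖z‖ ≤ ε → VecAsGood A ε (A.toEuclideanLin x₀ + z) x₀ x' →
    IsTopRestriction x₀ k xk →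
    ‖x₀ - x'‖ ≤ C₁ / Real.sqrt k * l1Norm (x₀ - xk) + C₂ * ε

/-- Robust recovery of vectors in the `ℓ₁` norm at noise level `ε`. -/
def VecL1Robust {m n : ℕ} (A : Matrix (Fin m) (Fin n) ℝ) (k : ℕ) (ε C₃ : ℝ) : Prop :=
  ∀ (x₀ x' xk : Vec n) (z : Vec m), ‖z‖ ≤ ε → VecAsGood A ε (A.toEuclideanLin x₀ + z) x₀ x' →
    IsTopRestriction x₀ k xk →
    l1Norm (x₀ - x') ≤ C₃ * l1Norm (x₀ - xk)

/-- Robust recovery of matrices in the Frobenius norm at noise level `ε`. -/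
def MatFrobRobust {m n₁ n₂ : ℕ} (𝒜 : MeasOp m n₁ n₂) (k : ℕ) (ε C₁ C₂ : ℝ) : Prop :=
  ∀ (X₀ X' Xk : Matrix (Fin n₁) (Fin n₂) ℝ) (z : Vec m), ‖z‖ ≤ ε →
    MatAsGood 𝒜 ε (𝒜 X₀ + z) X₀ X' → IsSVDTruncation X₀ k Xk →
    frobNorm (X₀ - X') ≤ C₁ / Real.sqrt k * nuclearNorm (X₀ - Xk) + C₂ * ε

/-- Robust recovery of matrices in the nuclear norm at noise level `ε`. -/
def MatNuclearRobust {m n₁ n₂ : ℕ} (𝒜 : MeasOp m n₁ n₂) (k : ℕ) (ε C₃ : ℝ) : Prop :=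
  ∀ (X₀ X' Xk : Matrix (Fin n₁) (Fin n₂) ℝ) (z : Vec m), ‖z‖ ≤ ε →
    MatAsGood 𝒜 ε (𝒜 X₀ + z) X₀ X' → IsSVDTruncation X₀ k Xk →
    nuclearNorm (X₀ - X') ≤ C₃ * nuclearNorm (X₀ - Xk)

end

end LowRank

open LowRank

namespace LowRank

open Matrix Module

/-! ### Singular value decomposition -/

/-! Transfer. Let `X₀ - X' = U diag(σ(X₀ - X')) Vᵀ` be a singular value decomposition of the error.
The map `x ↦ U diag(x) Vᵀ` preserves the Euclidean norm, turns sparsity into low rank and disjoint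
supports into orthogonal row and column spaces. Hence `x ↦ 𝒜 (U diag(x) Vᵀ)` has no larger
restricted constants than `𝒜` and inherits every RIP inequality. Apply the vector hypothesis to `x₀
= σ(X₀)` and `x' = σ(X₀) - σ(X₀ - X')`: error, residual and tail agree with those of the matrices,
although `U`, `V` need not diagonalize `X₀`. The one nontrivial point is that `x'` is as good as
`x₀`, that is `∑ |σᵢ(X₀) - σᵢ(X₀ - X')| ≤ ‖X'‖⋆`; this is Mirsky's inequality
`sum_abs_sigma_sub_le`.

Mirsky's inequality follows from a symmetric matrix `C` whose quadratic form dominates the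
self-adjoint dilations of both matrices and whose trace is the nuclear norm of their difference:
eigenvalues are monotone, those of a dilation are `±σⱼ` and zeros, and their sum is the trace.

Part (b) needs a vector theorem (`error_bounds`). Split the error `h` into its `k` largest entries
`a` and the rest `b`. Since `b` is flat and its `ℓ₁` norm is controlled, it is a convex combination
of `k`-sparse vectors, so `θ_{k,k}` bounds `⟨Ab, Aa⟩`. If `δ_k + θ_{k,k} < 1`, the lower isometry
bound for `a` absorbs this term. Both hypotheses of (b) give `δ_k + θ_{k,k} ≤ 0.96`. -/

theorem sigma_nonneg {n₁ n₂ : ℕ} (X : Matrix (Fin n₁) (Fin n₂) ℝ) (i : ℕ) : 0 ≤ sigma X i :=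
  X.toEuclideanLin.singularValues_nonneg i

theorem sigma_antitone {n₁ n₂ : ℕ} (X : Matrix (Fin n₁) (Fin n₂) ℝ) : Antitone (sigma X) :=
  X.toEuclideanLin.singularValues_antitone

theorem sigma_eq_zero_of_le {n₁ n₂ : ℕ} (X : Matrix (Fin n₁) (Fin n₂) ℝ) {i : ℕ} (hi : n₁ ≤ i) :
    sigma X i = 0 := by
  rw [sigma, LinearMap.singularValues_eq_zero_iff_le_finrank_range]
  refine le_trans (Submodule.finrank_le _) ?_
  simpa using hi

/-- Every linear map between Euclidean spaces has a singular value decomposition. -/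
theorem exists_singular_bases {n₁ n₂ : ℕ} (h : n₁ ≤ n₂) (T : Vec n₂ →ₗ[ℝ] Vec n₁) :
    ∃ (u : OrthonormalBasis (Fin n₁) ℝ (Vec n₁)) (v : OrthonormalBasis (Fin n₂) ℝ (Vec n₂)),
      (∀ i : Fin n₁, T (v (Fin.castLE h i)) = T.singularValues i • u i) ∧
      ∀ j : Fin n₂, n₁ ≤ j → T (v j) = 0 := by
  have hn : finrank ℝ (Vec n₂) = n₂ := by simp
  set hT := T.isSymmetric_adjoint_comp_self
  set v := hT.eigenvectorBasis hn with hv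
  have hinner : ∀ i j : Fin n₂, inner ℝ (T (v i)) (T (v j)) =
      if i = j then T.singularValues i ^ 2 else 0 := by
    intro i j
    have h1 : LinearMap.adjoint T (T (v j)) = (T.singularValues j ^ 2) • v j := by
      rw [T.sq_singularValues_fin hn]
      exact hT.apply_eigenvectorBasis hn j
    rw [← LinearMap.adjoint_inner_right, h1, inner_smul_right,
      orthonormal_iff_ite.mp v.orthonormal i j]
    split_ifs with hij
    · subst hij; simp
    · simp
  have hnorm : ∀ j : Fin n₂, T.singularValues j = 0 → T (v j) = 0 := by
    intro j hj
    rw [← inner_self_eq_zero (𝕜 := ℝ), hinner, if_pos rfl, hj]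
    simp
  -- The images `T vᵢ` are orthogonal of length `σᵢ`. The nonzero ones, normalized, extend to an
  -- orthonormal basis; where `σᵢ = 0` the choice of `uᵢ` is immaterial.
  let s : Set (Fin n₁) := {i | T.singularValues i ≠ 0}
  let w : Fin n₁ → Vec n₁ := fun i => (T.singularValues i)⁻¹ • T (v (Fin.castLE h i))
  have hw : Orthonormal ℝ (s.domRestrict w) := by
    rw [orthonormal_iff_ite]
    rintro ⟨i, hi⟩ ⟨j, hj⟩
    change inner ℝ (w i) (w j) = _
    simp only [w, inner_smul_left, inner_smul_right, hinner]
    by_cases hij : i = j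
    · subst hij
      have : T.singularValues i ≠ 0 := hi
      simp
      field_simp
    · have : ¬ (Fin.castLE h i = Fin.castLE h j) := fun e => hij (Fin.castLE_injective h e)
      simp [hij]
  obtain ⟨u, hu⟩ := hw.exists_orthonormalBasis_extension_of_card_eq (by simp)
  refine ⟨u, v, fun i => ?_, fun j hj => hnorm j ?_⟩
  · by_cases hi : T.singularValues i = 0
    · rw [hi, zero_smul]
      exact hnorm _ hi
    · rw [hu i hi]
      simp [w, smul_smul, hi]
  · rw [LinearMap.singularValues_eq_zero_iff_le_finrank_range]
    refine le_trans (Submodule.finrank_le _) ?_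
    simpa using hj

theorem inner_vec {n : ℕ} (x y : Vec n) : inner ℝ x y = ∑ i, x i * y i := by
  simp [PiLp.inner_apply, mul_comm]

/-- Existence of singular value decompositions of matrices. -/
theorem exists_svd {n₁ n₂ : ℕ} (h : n₁ ≤ n₂) (X : Matrix (Fin n₁) (Fin n₂) ℝ) :
    ∃ (U : Matrix (Fin n₁) (Fin n₁) ℝ) (V : Matrix (Fin n₂) (Fin n₁) ℝ), IsUnitaryPair U V ∧
      X = U * diagonal (fun i : Fin n₁ => sigma X i) * Vᵀ := by
  obtain ⟨u, v, huv, hv⟩ := exists_singular_bases h X.toEuclideanLin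
  let U : Matrix (Fin n₁) (Fin n₁) ℝ := Matrix.of fun i j => u j i
  let V : Matrix (Fin n₂) (Fin n₁) ℝ := Matrix.of fun i j => v (Fin.castLE h j) i
  have hU : Uᵀ * U = 1 := by
    ext i j
    have := orthonormal_iff_ite.mp u.orthonormal i j
    rw [inner_vec] at this
    simpa [Matrix.mul_apply, U, Matrix.one_apply] using this
  have hV : Vᵀ * V = 1 := by
    ext i j
    have := orthonormal_iff_ite.mp v.orthonormal (Fin.castLE h i) (Fin.castLE h j)
    rw [inner_vec] at this
    simpa [Matrix.mul_apply, V, Matrix.one_apply] using this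
  refine ⟨U, V, ⟨hU, mul_eq_one_comm.mp hU, hV⟩, ?_⟩
  apply Matrix.toEuclideanLin.injective
  refine v.toBasis.ext fun j => ?_
  have hVv : ∀ i : Fin n₁, (Vᵀ *ᵥ (v j).ofLp) i = if Fin.castLE h i = j then 1 else 0 := by
    intro i
    have := orthonormal_iff_ite.mp v.orthonormal (Fin.castLE h i) j
    rw [inner_vec] at this
    simpa [Matrix.mulVec, dotProduct, V] using this
  rw [OrthonormalBasis.coe_toBasis, Matrix.toLpLin_apply 2 2 (U * _ * _)]
  rw [← Matrix.mulVec_mulVec, ← Matrix.mulVec_mulVec]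
  by_cases hj : n₁ ≤ j
  · rw [hv j hj]
    have : Vᵀ *ᵥ (v j).ofLp = 0 := by
      ext i
      rw [hVv, if_neg, Pi.zero_apply]
      intro e
      have := congrArg Fin.val e
      simp at this
      omega
    simp [this]
  · push Not at hj
    obtain ⟨i, rfl⟩ : ∃ i : Fin n₁, Fin.castLE h i = j := ⟨⟨j, hj⟩, rfl⟩
    rw [huv]
    have : Vᵀ *ᵥ (v (Fin.castLE h i)).ofLp = Pi.single i 1 := by
      ext l
      rw [hVv, Pi.single_apply]
      simp
    rw [this]
    ext l
    simp [U, sigma, mul_comm, Matrix.mulVec, dotProduct, Pi.single_apply,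
      Matrix.diagonal_apply]

/-! ### Norms of matrices in diagonalized form -/

/-- Bessel's inequality for a matrix with orthonormal columns. -/
theorem transpose_mulVec_dotProduct_self_le {m n : Type*} [Fintype m] [Fintype n] [DecidableEq n]
    {V : Matrix m n ℝ} (hV : Vᵀ * V = 1) (b : m → ℝ) :
    Vᵀ *ᵥ b ⬝ᵥ Vᵀ *ᵥ b ≤ b ⬝ᵥ b := by
  have h1 : 0 ≤ (b - V *ᵥ (Vᵀ *ᵥ b)) ⬝ᵥ (b - V *ᵥ (Vᵀ *ᵥ b)) := by
    simpa using dotProduct_star_self_nonneg (b - V *ᵥ (Vᵀ *ᵥ b))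
  have h2 : b ⬝ᵥ V *ᵥ (Vᵀ *ᵥ b) = Vᵀ *ᵥ b ⬝ᵥ Vᵀ *ᵥ b := by
    rw [dotProduct_mulVec, ← mulVec_transpose]
  have h3 : V *ᵥ (Vᵀ *ᵥ b) ⬝ᵥ V *ᵥ (Vᵀ *ᵥ b) = Vᵀ *ᵥ b ⬝ᵥ Vᵀ *ᵥ b := by
    rw [dotProduct_mulVec, ← mulVec_transpose, mulVec_mulVec, hV, one_mulVec]
  rw [sub_dotProduct, dotProduct_sub, dotProduct_sub, h3,
    dotProduct_comm (V *ᵥ Vᵀ *ᵥ b) b, h2] at h1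
  linarith

/-- An isometry preserves the dot product of a vector with itself. -/
theorem mulVec_dotProduct_self {m n : Type*} [Fintype m] [Fintype n] [DecidableEq n]
    {V : Matrix m n ℝ} (hV : Vᵀ * V = 1) (b : n → ℝ) :
    V *ᵥ b ⬝ᵥ V *ᵥ b = b ⬝ᵥ b := by
  rw [dotProduct_mulVec, ← mulVec_transpose, mulVec_mulVec, hV, one_mulVec]

/-- With `P = Uᵀ U'` and `Q = V'ᵀ V`, `dᵢ = ∑ⱼ Pᵢⱼ d'ⱼ Qⱼᵢ`. Columns of `P` and rows of `Q` have
norm at most 1, so by the inequality of arithmetic and geometric means each `d'ⱼ` enters the sum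
with total weight at most 1. Applied in both directions, this makes the sum of a nonnegative
diagonal independent of the decomposition. -/
theorem sum_le_sum_of_mul_diagonal_eq {n₁ n₂ : ℕ} {U U' : Matrix (Fin n₁) (Fin n₁) ℝ}
    {V V' : Matrix (Fin n₂) (Fin n₁) ℝ} (h : IsUnitaryPair U V) (h' : IsUnitaryPair U' V')
    {d d' : Fin n₁ → ℝ} (hd' : ∀ i, 0 ≤ d' i)
    (heq : U * diagonal d * Vᵀ = U' * diagonal d' * V'ᵀ) : ∑ i, d i ≤ ∑ i, d' i := by
  obtain ⟨hU, -, hV⟩ := h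
  obtain ⟨hU', -, hV'⟩ := h'
  have hU2 : U * Uᵀ = 1 := mul_eq_one_comm.mp hU
  set P := Uᵀ * U' with hP
  set Q := V'ᵀ * V with hQ
  have hdiag : diagonal d = P * diagonal d' * Q := by
    calc diagonal d = (Uᵀ * U) * diagonal d * (Vᵀ * V) := by simp [hU, hV]
      _ = Uᵀ * (U * diagonal d * Vᵀ) * V := by simp only [Matrix.mul_assoc]
      _ = P * diagonal d' * Q := by rw [heq, hP, hQ]; simp only [Matrix.mul_assoc]
  have hPcol : ∀ j, ∑ i, P i j ^ 2 = 1 := by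
    intro j
    have : (Pᵀ * P) j j = 1 := by
      have : Pᵀ * P = 1 := by
        rw [hP, transpose_mul, transpose_transpose, Matrix.mul_assoc, ← Matrix.mul_assoc U, hU2,
          Matrix.one_mul, hU']
      simp [this]
    simpa [Matrix.mul_apply, sq] using this
  have hQrow : ∀ j, ∑ i, Q j i ^ 2 ≤ 1 := by
    intro j
    have h1 := transpose_mulVec_dotProduct_self_le hV (fun i => V' i j)
    have h2 : (fun i => V' i j) ⬝ᵥ (fun i => V' i j) = 1 := by
      have := congrFun (congrFun hV' j) j
      simpa [Matrix.mul_apply, dotProduct] using this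
    rw [h2] at h1
    refine le_trans (le_of_eq ?_) h1
    simp [dotProduct, Matrix.mulVec, hQ, Matrix.mul_apply, sq, mul_comm]
  have hdi : ∀ i, d i = ∑ j, P i j * d' j * Q j i := by
    intro i
    have := congrFun (congrFun hdiag i) i
    rw [diagonal_apply_eq, Matrix.mul_apply] at this
    simpa [Matrix.mul_diagonal] using this
  calc ∑ i, d i = ∑ j, ∑ i, P i j * d' j * Q j i := by
        rw [Finset.sum_comm]; exact Finset.sum_congr rfl fun i _ => hdi i
    _ ≤ ∑ j, d' j := by
        refine Finset.sum_le_sum fun j _ => ?_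
        calc ∑ i, P i j * d' j * Q j i ≤ ∑ i, d' j * ((P i j ^ 2 + Q j i ^ 2) / 2) := by
              refine Finset.sum_le_sum fun i _ => ?_
              nlinarith [mul_nonneg (hd' j) (sq_nonneg (P i j - Q j i))]
          _ = d' j * ((∑ i, P i j ^ 2 + ∑ i, Q j i ^ 2) / 2) := by
              rw [← Finset.mul_sum, ← Finset.sum_div, Finset.sum_add_distrib]
          _ ≤ d' j * 1 := by
              refine mul_le_mul_of_nonneg_left ?_ (hd' j)
              linarith [hPcol j, hQrow j]
          _ = d' j := mul_one _

theorem nuclearNorm_mul_diagonal {n₁ n₂ : ℕ} (hn : n₁ ≤ n₂) {U : Matrix (Fin n₁) (Fin n₁) ℝ}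
    {V : Matrix (Fin n₂) (Fin n₁) ℝ} (h : IsUnitaryPair U V) {d : Fin n₁ → ℝ}
    (hd : ∀ i, 0 ≤ d i) : nuclearNorm (U * diagonal d * Vᵀ) = ∑ i, d i := by
  obtain ⟨U', V', h', heq⟩ := exists_svd hn (U * diagonal d * Vᵀ)
  exact le_antisymm (sum_le_sum_of_mul_diagonal_eq h' h hd heq.symm)
    (sum_le_sum_of_mul_diagonal_eq h h' (fun i => sigma_nonneg _ _) heq)

theorem frobNorm_mul_diagonal {n₁ n₂ : ℕ} {U : Matrix (Fin n₁) (Fin n₁) ℝ}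
    {V : Matrix (Fin n₂) (Fin n₁) ℝ} (h : IsUnitaryPair U V) (x : Vec n₁) :
    frobNorm (U * diagonal x.ofLp * Vᵀ) = ‖x‖ := by
  obtain ⟨hU, -, hV⟩ := h
  rw [frobNorm, EuclideanSpace.norm_eq]
  congr 1
  set X := U * diagonal x.ofLp * Vᵀ with hX
  have h1 : ∑ i, ∑ j, X i j ^ 2 = (Xᵀ * X).trace := by
    rw [Finset.sum_comm]
    simp [Matrix.trace, Matrix.mul_apply, sq]
  have h2 : Xᵀ * X = V * (diagonal x.ofLp * diagonal x.ofLp) * Vᵀ := by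
    calc Xᵀ * X = V * diagonal x.ofLp * (Uᵀ * U) * diagonal x.ofLp * Vᵀ := by
          rw [hX]; simp only [transpose_mul, diagonal_transpose, transpose_transpose,
            Matrix.mul_assoc]
      _ = _ := by rw [hU]; simp only [Matrix.mul_assoc, Matrix.mul_one]
  rw [h1, h2, Matrix.trace_mul_cycle, hV, Matrix.one_mul, diagonal_mul_diagonal, trace_diagonal]
  simp [sq]

/-! ### A lower bound for eigenvalues -/

/-- The easy half of the Courant–Fischer theorem: if the quadratic form of `C` is at least `c` on
an injective image of the kernel of `φ`, and this kernel has dimension greater than `i`, then the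
`i`-th largest eigenvalue is at least `c`. -/
theorem le_eigenvalues₀ {ι W : Type*} [Fintype ι] [DecidableEq ι] [AddCommGroup W] [Module ℝ W]
    [FiniteDimensional ℝ W] {C : Matrix ι ι ℝ} (hC : C.IsHermitian) (i : Fin (Fintype.card ι))
    (L : W →ₗ[ℝ] ι → ℝ) (hL : Function.Injective L) {r : Type*} [Fintype r]
    (φ : W →ₗ[ℝ] r → ℝ) (hr : Fintype.card r + i < finrank ℝ W) {c : ℝ}
    (h : ∀ w, φ w = 0 → c * (L w ⬝ᵥ L w) ≤ L w ⬝ᵥ C *ᵥ L w) : c ≤ hC.eigenvalues₀ i := by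
  have hT : (Matrix.toEuclideanLin C).IsSymmetric := Matrix.isSymmetric_toEuclideanLin_iff.2 hC
  set e := hT.eigenvectorBasis finrank_euclideanSpace with he
  have hlam : hC.eigenvalues₀ = hT.eigenvalues finrank_euclideanSpace := rfl
  let ψ : W →ₗ[ℝ] Fin i → ℝ := LinearMap.pi fun j =>
    (innerₛₗ ℝ (e ⟨j, j.2.trans i.2⟩)).comp
      ((WithLp.linearEquiv 2 ℝ (ι → ℝ)).symm.toLinearMap.comp L)
  -- Dimension count: some nonzero `w` satisfies `φ w = 0` with `L w` orthogonal to the first `i`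
  -- eigenvectors. Its Rayleigh quotient is at least `c` and at most the `i`-th eigenvalue.
  have hker : (φ.prod ψ).ker ≠ ⊥ := by
    apply LinearMap.ker_ne_bot_of_finrank_lt
    simpa using hr
  obtain ⟨w, hw, hw0⟩ := Submodule.exists_mem_ne_zero_of_ne_bot hker
  have hφ : φ w = 0 := by
    have := congrArg Prod.fst (LinearMap.mem_ker.mp hw); simpa using this
  have hψ : ψ w = 0 := by
    have := congrArg Prod.snd (LinearMap.mem_ker.mp hw); simpa using this
  set x : EuclideanSpace ℝ ι := WithLp.toLp 2 (L w) with hx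
  have hxe : ∀ j : Fin (Fintype.card ι), j < i → inner ℝ (e j) x = 0 := fun j hj =>
    congrFun hψ ⟨j, hj⟩
  have hx0 : 0 < ‖x‖ ^ 2 := by
    have : x ≠ 0 := by
      intro h0
      apply hw0
      apply hL
      rw [map_zero]
      simpa [hx] using h0
    positivity
  have hxx : L w ⬝ᵥ L w = ‖x‖ ^ 2 := by
    rw [EuclideanSpace.norm_sq_eq]
    simp [dotProduct, hx, sq]
  have hxC : L w ⬝ᵥ C *ᵥ L w = ∑ j, hT.eigenvalues finrank_euclideanSpace j *
      inner ℝ (e j) x ^ 2 := by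
    have h1 : L w ⬝ᵥ C *ᵥ L w = inner ℝ x (Matrix.toEuclideanLin C x) := by
      rw [EuclideanSpace.inner_eq_star_dotProduct, dotProduct_comm]
      simp [hx, Matrix.toLpLin_apply]
    rw [h1, ← e.sum_inner_mul_inner]
    refine Finset.sum_congr rfl fun j _ => ?_
    rw [← hT (e j) x, hT.apply_eigenvectorBasis, inner_smul_left, real_inner_comm]
    simp
    ring
  have hle := h w hφ
  rw [hxx, hxC] at hle
  have hup : ∑ j, hT.eigenvalues finrank_euclideanSpace j * inner ℝ (e j) x ^ 2 ≤
      hC.eigenvalues₀ i * ‖x‖ ^ 2 := by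
    rw [← e.sum_sq_norm_inner_right x, Finset.mul_sum]
    refine Finset.sum_le_sum fun j _ => ?_
    rcases lt_or_ge j i with hj | hj
    · simp [hxe j hj]
    · rw [Real.norm_eq_abs, sq_abs]
      exact mul_le_mul_of_nonneg_right (hC.eigenvalues₀_antitone hj) (sq_nonneg _)
  exact le_of_mul_le_mul_right (hle.trans hup) hx0

/-! ### Perturbation of singular values -/

theorem dotProduct_mul_diagonal_mulVec {m n l : Type*} [Fintype m] [Fintype n] [Fintype l]
    [DecidableEq l] (P : Matrix m l ℝ) (d : l → ℝ) (Q : Matrix n l ℝ) (a : m → ℝ) (b : n → ℝ) :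
    a ⬝ᵥ (P * diagonal d * Qᵀ) *ᵥ b = ∑ i, d i * ((Pᵀ *ᵥ a) i * (Qᵀ *ᵥ b) i) := by
  rw [← mulVec_mulVec, ← mulVec_mulVec, dotProduct_mulVec, ← mulVec_transpose, dotProduct]
  refine Finset.sum_congr rfl fun i _ => ?_
  rw [mulVec_diagonal]
  ring

/-- If the quadratic form of `C` dominates that of the self-adjoint dilation of `Z`, then the
eigenvalues of `C` dominate those of the dilation. -/
theorem sigma_le_eigenvalues₀ {n₁ n₂ : ℕ} (hn : n₁ ≤ n₂) (Z : Matrix (Fin n₁) (Fin n₂) ℝ)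
    {C : Matrix (Fin n₁ ⊕ Fin n₂) (Fin n₁ ⊕ Fin n₂) ℝ} (hC : C.IsHermitian)
    (hq : ∀ a b, 2 * (a ⬝ᵥ Z *ᵥ b) ≤ Sum.elim a b ⬝ᵥ C *ᵥ Sum.elim a b)
    (i : Fin (Fintype.card (Fin n₁ ⊕ Fin n₂))) :
    ((i : ℕ) < n₁ → sigma Z i ≤ hC.eigenvalues₀ i) ∧
    ((i : ℕ) < n₂ → 0 ≤ hC.eigenvalues₀ i) ∧
    (∀ j < n₁, (i : ℕ) + j + 1 = n₁ + n₂ → - sigma Z j ≤ hC.eigenvalues₀ i) := by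
  obtain ⟨U, V, ⟨hU, -, hV⟩, hZ⟩ := exists_svd hn Z
  have hform : ∀ a b, a ⬝ᵥ Z *ᵥ b =
      ∑ i : Fin n₁, sigma Z i * ((Uᵀ *ᵥ a) i * (Vᵀ *ᵥ b) i) := fun a b => by
    conv_lhs => rw [hZ]
    exact dotProduct_mul_diagonal_mulVec U _ V a b
  have hcard : finrank ℝ (Fin n₁ ⊕ Fin n₂ → ℝ) = n₁ + n₂ := by simp
  -- On the subspace of codimension at most `j` where the first `j` coordinates of `Uᵀ a` and `Vᵀ b`
  -- agree, those terms of the form are nonnegative, and the others are bounded by `2αβ ≥ -(α² +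
  -- β²)`. The choices `j = n₁`, `c = 0` and `c = σⱼ` give the last two claims.
  have hlow : ∀ (j : ℕ) (hj : j ≤ n₁) (c : ℝ), 0 ≤ c → (∀ l, j ≤ l → sigma Z l ≤ c) →
      j + i < n₁ + n₂ → -c ≤ hC.eigenvalues₀ i := by
    intro j hj c hc hσ hji
    let φ : (Fin n₁ ⊕ Fin n₂ → ℝ) →ₗ[ℝ] Fin j → ℝ := LinearMap.pi fun l =>
      (LinearMap.proj (Fin.castLE hj l)).comp
        (Uᵀ.mulVecLin.comp (LinearMap.funLeft ℝ ℝ Sum.inl) -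
          Vᵀ.mulVecLin.comp (LinearMap.funLeft ℝ ℝ Sum.inr))
    refine le_eigenvalues₀ hC i LinearMap.id Function.injective_id φ
      (by rw [hcard]; simpa using hji) fun w hw => ?_
    set a : Fin n₁ → ℝ := w ∘ Sum.inl with ha
    set b : Fin n₂ → ℝ := w ∘ Sum.inr with hb
    have hwab : w = Sum.elim a b := (Sum.elim_comp_inl_inr w).symm
    have hφ : ∀ l : Fin n₁, (l : ℕ) < j → (Uᵀ *ᵥ a) l = (Vᵀ *ᵥ b) l := fun l hl =>
      sub_eq_zero.mp (congrFun hw ⟨l, hl⟩)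
    rw [LinearMap.id_apply]
    refine le_trans ?_ (hwab ▸ hq a b)
    have hBU : Uᵀ *ᵥ a ⬝ᵥ Uᵀ *ᵥ a ≤ a ⬝ᵥ a := transpose_mulVec_dotProduct_self_le hU a
    have hBV : Vᵀ *ᵥ b ⬝ᵥ Vᵀ *ᵥ b ≤ b ⬝ᵥ b := transpose_mulVec_dotProduct_self_le hV b
    have hww : w ⬝ᵥ w = a ⬝ᵥ a + b ⬝ᵥ b := by
      rw [hwab, sumElim_dotProduct_sumElim]
    calc -c * (w ⬝ᵥ w) ≤ -c * (Uᵀ *ᵥ a ⬝ᵥ Uᵀ *ᵥ a + Vᵀ *ᵥ b ⬝ᵥ Vᵀ *ᵥ b) := by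
          rw [hww]; nlinarith
      _ = ∑ l, -c * ((Uᵀ *ᵥ a) l * (Uᵀ *ᵥ a) l + (Vᵀ *ᵥ b) l * (Vᵀ *ᵥ b) l) := by
          rw [dotProduct, dotProduct, ← Finset.sum_add_distrib, Finset.mul_sum]
      _ ≤ ∑ l : Fin n₁, 2 * (sigma Z l * ((Uᵀ *ᵥ a) l * (Vᵀ *ᵥ b) l)) := by
          refine Finset.sum_le_sum fun l _ => ?_
          have h0 := sigma_nonneg Z l
          set α := (Uᵀ *ᵥ a) l
          set β := (Vᵀ *ᵥ b) l
          by_cases hl : (l : ℕ) < j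
          · have : α = β := hφ l hl
            rw [this]
            nlinarith [mul_nonneg h0 (mul_self_nonneg β), mul_nonneg hc (mul_self_nonneg β)]
          · have h1 := hσ l (not_lt.mp hl)
            nlinarith [mul_nonneg h0 (sq_nonneg (α + β)),
              mul_nonneg (sub_nonneg.mpr h1) (add_nonneg (sq_nonneg α) (sq_nonneg β))]
      _ = 2 * (a ⬝ᵥ Z *ᵥ b) := by rw [hform, Finset.mul_sum]
  refine ⟨fun hi => ?_, fun hi => ?_, fun j hj hij => ?_⟩
  -- Test vectors `(Uw, Vw)` with `w` supported on the coordinates `0, …, i`: there the dilation has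
  -- form `2 ∑ σₗ wₗ² ≥ 2 σᵢ ‖w‖²`.
  · let L : (Fin n₁ → ℝ) →ₗ[ℝ] Fin n₁ ⊕ Fin n₂ → ℝ :=
      { toFun := fun w => Sum.elim (U *ᵥ w) (V *ᵥ w)
        map_add' := fun x y => by
          ext s; cases s <;> simp [mulVec_add]
        map_smul' := fun c x => by
          ext s; cases s <;> simp [mulVec_smul] }
    have hLapp : ∀ w, L w = Sum.elim (U *ᵥ w) (V *ᵥ w) := fun w => rfl
    have hLL : ∀ w, L w ⬝ᵥ L w = 2 * (w ⬝ᵥ w) := fun w => by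
      rw [hLapp, sumElim_dotProduct_sumElim, mulVec_dotProduct_self hU, mulVec_dotProduct_self hV]
      ring
    have hinj : Function.Injective L := by
      rw [injective_iff_map_eq_zero]
      intro w hw
      have := hLL w
      rw [hw, dotProduct_zero] at this
      exact dotProduct_self_eq_zero.mp (by linarith)
    let φ : (Fin n₁ → ℝ) →ₗ[ℝ] {l : Fin n₁ // (i : ℕ) < l} → ℝ :=
      LinearMap.pi fun l => LinearMap.proj l.1
    refine le_eigenvalues₀ hC i L hinj φ ?_ fun w hw => ?_
    · have : Fintype.card {l : Fin n₁ // (i : ℕ) < l} = n₁ - 1 - i := by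
        rw [Fintype.card_subtype]
        convert Fin.card_Ioi (⟨i, hi⟩ : Fin n₁) using 2
        ext l
        simp [Fin.lt_def]
      rw [this]
      simp
      omega
    · have hφ : ∀ l : Fin n₁, (i : ℕ) < l → w l = 0 := fun l hl => congrFun hw ⟨l, hl⟩
      rw [hLL, hLapp]
      refine le_trans ?_ (hq _ _)
      rw [hform, mulVec_mulVec, mulVec_mulVec, hU, hV, one_mulVec]
      have : sigma Z i * (w ⬝ᵥ w) ≤ ∑ l : Fin n₁, sigma Z l * (w l * w l) := by
        rw [dotProduct, Finset.mul_sum]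
        refine Finset.sum_le_sum fun l _ => ?_
        by_cases hl : (i : ℕ) < l
        · simp [hφ l hl]
        · exact mul_le_mul_of_nonneg_right (sigma_antitone Z (not_lt.mp hl)) (mul_self_nonneg _)
      linarith
  · have := hlow n₁ le_rfl 0 le_rfl (fun l hl => (sigma_eq_zero_of_le Z hl).le) (by omega)
    simpa using this
  · exact hlow j hj.le _ (sigma_nonneg Z j) (fun l hl => sigma_antitone Z hl) (by omega)

/-- Pairs the `j`-th largest eigenvalue with the `j`-th smallest, as the dilation pairs `σⱼ` with
`-σⱼ`; the middle indices belong to its `n₂ - n₁` zero eigenvalues. -/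
theorem sum_range_eq_sum_add_reflect (g : ℕ → ℝ) {n₁ n₂ : ℕ} (hn : n₁ ≤ n₂) :
    ∑ i ∈ Finset.range (n₁ + n₂), g i =
      ∑ j ∈ Finset.range n₁, (g j + g (n₁ + n₂ - 1 - j)) + ∑ i ∈ Finset.Ico n₁ n₂, g i := by
  have h1 : ∑ j ∈ Finset.range n₁, g (n₁ + n₂ - 1 - j) = ∑ i ∈ Finset.Ico n₂ (n₁ + n₂), g i := by
    rw [Finset.sum_Ico_eq_sum_range, Nat.add_sub_cancel, ← Finset.sum_range_reflect]
    refine Finset.sum_congr rfl fun j hj => ?_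
    have := Finset.mem_range.mp hj
    congr 1
    omega
  rw [Finset.sum_add_distrib, h1, Finset.range_eq_Ico, Finset.range_eq_Ico,
    ← Finset.sum_Ico_consecutive g (Nat.zero_le n₂) (by omega : n₂ ≤ n₁ + n₂),
    ← Finset.sum_Ico_consecutive g (Nat.zero_le n₁) hn]
  ring

/-- Mirsky's inequality for the nuclear norm. -/
theorem sum_abs_sigma_sub_le {n₁ n₂ : ℕ} (hn : n₁ ≤ n₂) (X Y : Matrix (Fin n₁) (Fin n₂) ℝ) :
    ∑ i : Fin n₁, |sigma X i - sigma Y i| ≤ nuclearNorm (X - Y) := by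
  obtain ⟨U, V, ⟨hU, -, hV⟩, hD⟩ := exists_svd hn (X - Y)
  set τ : Fin n₁ → ℝ := fun i => sigma (X - Y) i with hτ
  have hτ0 : ∀ i, 0 ≤ τ i := fun i => sigma_nonneg _ _
  -- Half of the sum of the two dilations plus half of the absolute value of their difference; the
  -- latter is block diagonal with blocks `U τ Uᵀ` and `V τ Vᵀ`.
  let C : Matrix (Fin n₁ ⊕ Fin n₂) (Fin n₁ ⊕ Fin n₂) ℝ :=
    (1 / 2 : ℝ) • fromBlocks (U * diagonal τ * Uᵀ) (X + Y) (X + Y)ᵀ (V * diagonal τ * Vᵀ)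
  have hC : C.IsHermitian := by
    rw [Matrix.IsHermitian, conjTranspose_eq_transpose_of_trivial]
    simp only [C, transpose_smul, fromBlocks_transpose, transpose_mul, transpose_transpose,
      diagonal_transpose, Matrix.mul_assoc]
  have htr : C.trace = ∑ i, τ i := by
    have h1 : (U * diagonal τ * Uᵀ).trace = ∑ i, τ i := by
      rw [trace_mul_cycle, hU, Matrix.one_mul, trace_diagonal]
    have h2 : (V * diagonal τ * Vᵀ).trace = ∑ i, τ i := by
      rw [trace_mul_cycle, hV, Matrix.one_mul, trace_diagonal]
    simp only [C]
    rw [trace_smul, Matrix.trace, Fintype.sum_sum_type]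
    simp only [diag_apply, fromBlocks_apply₁₁, fromBlocks_apply₂₂]
    simp only [Matrix.trace, diag_apply] at h1 h2
    rw [h1, h2, smul_eq_mul]
    ring
  have hquad : ∀ a b, Sum.elim a b ⬝ᵥ C *ᵥ Sum.elim a b =
      1 / 2 * ∑ i, τ i * ((Uᵀ *ᵥ a) i ^ 2 + (Vᵀ *ᵥ b) i ^ 2) + a ⬝ᵥ X *ᵥ b + a ⬝ᵥ Y *ᵥ b := by
    intro a b
    have h1 : b ⬝ᵥ (X + Y)ᵀ *ᵥ a = a ⬝ᵥ (X + Y) *ᵥ b := by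
      rw [mulVec_transpose, dotProduct_comm, ← dotProduct_mulVec]
    simp only [C, smul_mulVec, dotProduct_smul, fromBlocks_mulVec, Sum.elim_comp_inl,
      Sum.elim_comp_inr, sumElim_dotProduct_sumElim, dotProduct_add, h1,
      dotProduct_mul_diagonal_mulVec, mul_add, Finset.sum_add_distrib, smul_eq_mul, sq, add_mulVec]
    ring
  have hdiff : ∀ a b, a ⬝ᵥ X *ᵥ b - a ⬝ᵥ Y *ᵥ b =
      ∑ i, τ i * ((Uᵀ *ᵥ a) i * (Vᵀ *ᵥ b) i) := by
    intro a b
    rw [← dotProduct_mul_diagonal_mulVec, ← hD, sub_mulVec, dotProduct_sub]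
  have habs : ∀ a b, |∑ i, τ i * ((Uᵀ *ᵥ a) i * (Vᵀ *ᵥ b) i)| ≤
      1 / 2 * ∑ i, τ i * ((Uᵀ *ᵥ a) i ^ 2 + (Vᵀ *ᵥ b) i ^ 2) := by
    intro a b
    refine (Finset.abs_sum_le_sum_abs _ _).trans ?_
    rw [Finset.mul_sum]
    refine Finset.sum_le_sum fun i _ => ?_
    rw [abs_mul, abs_of_nonneg (hτ0 i)]
    have : |(Uᵀ *ᵥ a) i * (Vᵀ *ᵥ b) i| ≤ 1 / 2 * ((Uᵀ *ᵥ a) i ^ 2 + (Vᵀ *ᵥ b) i ^ 2) := by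
      rw [abs_le]
      constructor <;> nlinarith [sq_nonneg ((Uᵀ *ᵥ a) i + (Vᵀ *ᵥ b) i),
        sq_nonneg ((Uᵀ *ᵥ a) i - (Vᵀ *ᵥ b) i)]
    calc τ i * |(Uᵀ *ᵥ a) i * (Vᵀ *ᵥ b) i|
        ≤ τ i * (1 / 2 * ((Uᵀ *ᵥ a) i ^ 2 + (Vᵀ *ᵥ b) i ^ 2)) :=
          mul_le_mul_of_nonneg_left this (hτ0 i)
      _ = _ := by ring
  have hX := sigma_le_eigenvalues₀ hn X hC fun a b => by
    rw [hquad]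
    have := (abs_le.mp (habs a b)).2
    linarith [hdiff a b]
  have hY := sigma_le_eigenvalues₀ hn Y hC fun a b => by
    rw [hquad]
    have := (abs_le.mp (habs a b)).1
    linarith [hdiff a b]
  have hcard : Fintype.card (Fin n₁ ⊕ Fin n₂) = n₁ + n₂ := by simp
  let g : ℕ → ℝ := fun i => if h : i < Fintype.card (Fin n₁ ⊕ Fin n₂) then
    hC.eigenvalues₀ ⟨i, h⟩ else 0
  have hsum : ∑ i ∈ Finset.range (n₁ + n₂), g i = ∑ i, τ i := by
    rw [← htr, hC.trace_eq_sum_eigenvalues, ← hcard, ← Fin.sum_univ_eq_sum_range]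
    have : ∀ i, hC.eigenvalues i =
      hC.eigenvalues₀ ((Fintype.equivOfCardEq (Fintype.card_fin _)).symm i) := fun i => rfl
    simp only [this, RCLike.ofReal_real_eq_id, id]
    rw [Equiv.sum_comp]
    refine Finset.sum_congr rfl fun i _ => ?_
    simp only [g, dif_pos i.2]
  have hgmid : 0 ≤ ∑ i ∈ Finset.Ico n₁ n₂, g i := by
    refine Finset.sum_nonneg fun i hi => ?_
    have hi' := Finset.mem_Ico.mp hi
    have hlt : i < Fintype.card (Fin n₁ ⊕ Fin n₂) := by omega
    simp only [g, dif_pos hlt]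
    exact (hX ⟨i, hlt⟩).2.1 hi'.2
  calc ∑ i : Fin n₁, |sigma X i - sigma Y i|
      = ∑ j ∈ Finset.range n₁, |sigma X j - sigma Y j| :=
        Fin.sum_univ_eq_sum_range (fun j => |sigma X j - sigma Y j|) n₁
    _ ≤ ∑ j ∈ Finset.range n₁, (g j + g (n₁ + n₂ - 1 - j)) := by
        refine Finset.sum_le_sum fun j hj => ?_
        have hj' := Finset.mem_range.mp hj
        have hlt : j < Fintype.card (Fin n₁ ⊕ Fin n₂) := by omega
        have hlt' : n₁ + n₂ - 1 - j < Fintype.card (Fin n₁ ⊕ Fin n₂) := by omega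
        simp only [g, dif_pos hlt, dif_pos hlt']
        -- The upper eigenvalue is at least `max (σⱼ X) (σⱼ Y)`, the mirrored one at least `-min (σⱼ
        -- X) (σⱼ Y)`.
        have h1 := (hX ⟨j, hlt⟩).1 hj'
        have h2 := (hY ⟨j, hlt⟩).1 hj'
        have h3 := (hX ⟨_, hlt'⟩).2.2 j hj' (by simp only; omega)
        have h4 := (hY ⟨_, hlt'⟩).2.2 j hj' (by simp only; omega)
        simp only at h1 h2
        rw [abs_le]
        constructor <;> linarith
    _ ≤ ∑ i ∈ Finset.range (n₁ + n₂), g i := by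
        rw [sum_range_eq_sum_add_reflect g hn]; linarith
    _ = nuclearNorm (X - Y) := hsum

/-! ### Restriction of a measurement operator to the matrices with given singular vectors -/

theorem frobNorm_nonneg {n₁ n₂ : ℕ} (X : Matrix (Fin n₁) (Fin n₂) ℝ) : 0 ≤ frobNorm X :=
  Real.sqrt_nonneg _

theorem abs_apply_le_frobNorm {n₁ n₂ : ℕ} (X : Matrix (Fin n₁) (Fin n₂) ℝ) (i : Fin n₁)
    (j : Fin n₂) : |X i j| ≤ frobNorm X := by
  refine Real.abs_le_sqrt ?_
  refine le_trans ?_ (Finset.single_le_sum (f := fun i => ∑ j, X i j ^ 2)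
    (fun i _ => Finset.sum_nonneg fun j _ => sq_nonneg _) (Finset.mem_univ i))
  exact Finset.single_le_sum (f := fun j => X i j ^ 2) (fun j _ => sq_nonneg _) (Finset.mem_univ j)

/-- Makes the sets defining `opRIC` and `opROC` nonempty; otherwise their `sInf` would be the
default 0 and could not be compared. -/
theorem exists_norm_le_mul_frobNorm {m n₁ n₂ : ℕ} (𝒜 : MeasOp m n₁ n₂) :
    ∃ K : ℝ, 0 ≤ K ∧ ∀ X, ‖𝒜 X‖ ≤ K * frobNorm X := by
  refine ⟨∑ i, ∑ j, ‖𝒜 (Matrix.single i j 1)‖, by positivity, fun X => ?_⟩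
  conv_lhs => rw [matrix_eq_sum_single X]
  rw [map_sum, Finset.sum_mul]
  refine (norm_sum_le _ _).trans (Finset.sum_le_sum fun i _ => ?_)
  rw [map_sum, Finset.sum_mul]
  refine (norm_sum_le _ _).trans (Finset.sum_le_sum fun j _ => ?_)
  have : Matrix.single i j (X i j) = X i j • Matrix.single i j (1 : ℝ) := by simp
  rw [this, map_smul, norm_smul, Real.norm_eq_abs, mul_comm]
  exact mul_le_mul_of_nonneg_left (abs_apply_le_frobNorm X i j) (norm_nonneg _)

theorem rank_mul_diagonal_le {n₁ n₂ : ℕ} (U : Matrix (Fin n₁) (Fin n₁) ℝ)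
    (V : Matrix (Fin n₂) (Fin n₁) ℝ) (x : Vec n₁) :
    (U * diagonal x.ofLp * Vᵀ).rank ≤ nnzCount x := by
  classical
  refine (rank_mul_le_left _ _).trans ((rank_mul_le_right _ _).trans ?_)
  rw [rank_diagonal, Fintype.card_subtype, nnzCount]

/-- The matrix of the measurement operator `x ↦ 𝒜 (U diag(x) Vᵀ)`. -/
noncomputable def compression {m n₁ n₂ : ℕ} (𝒜 : MeasOp m n₁ n₂)
    (U : Matrix (Fin n₁) (Fin n₁) ℝ) (V : Matrix (Fin n₂) (Fin n₁) ℝ) :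
    Matrix (Fin m) (Fin n₁) ℝ :=
  Matrix.toEuclideanLin.symm
    { toFun := fun x => 𝒜 (U * diagonal x.ofLp * Vᵀ)
      map_add' := fun x y => by
        rw [← map_add, ← Matrix.add_mul, ← Matrix.mul_add, diagonal_add]
        rfl
      map_smul' := fun c x => by
        rw [RingHom.id_apply, ← map_smul, ← Matrix.smul_mul, ← Matrix.mul_smul, ← diagonal_smul]
        rfl }

theorem compression_apply {m n₁ n₂ : ℕ} (𝒜 : MeasOp m n₁ n₂)
    (U : Matrix (Fin n₁) (Fin n₁) ℝ) (V : Matrix (Fin n₂) (Fin n₁) ℝ) (x : Vec n₁) :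
    (compression 𝒜 U V).toEuclideanLin x = 𝒜 (U * diagonal x.ofLp * Vᵀ) := by
  rw [compression, LinearEquiv.apply_symm_apply]
  rfl

theorem vecRIC_nonneg {m n : ℕ} (A : Matrix (Fin m) (Fin n) ℝ) (k : ℕ) : 0 ≤ vecRIC A k :=
  Real.sInf_nonneg fun _ h => h.1

theorem vecROC_nonneg {m n : ℕ} (A : Matrix (Fin m) (Fin n) ℝ) (k k' : ℕ) : 0 ≤ vecROC A k k' :=
  Real.sInf_nonneg fun _ h => h.1

/-- Every constant admissible for `𝒜` is admissible for the compression, since `x ↦ U diag(x) Vᵀ` is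
isometric and sends `k`-sparse vectors to matrices of rank at most `k`. -/
theorem vecRIC_compression_le {m n₁ n₂ : ℕ} (𝒜 : MeasOp m n₁ n₂)
    {U : Matrix (Fin n₁) (Fin n₁) ℝ} {V : Matrix (Fin n₂) (Fin n₁) ℝ} (h : IsUnitaryPair U V)
    (k : ℕ) : vecRIC (compression 𝒜 U V) k ≤ opRIC 𝒜 k := by
  refine csInf_le_csInf ⟨0, fun _ h => h.1⟩ ?_ ?_
  · obtain ⟨K, hK, hb⟩ := exists_norm_le_mul_frobNorm 𝒜
    have hb2 : ∀ X, ‖𝒜 X‖ ^ 2 ≤ K ^ 2 * frobNorm X ^ 2 := fun X => by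
      rw [← mul_pow]; exact pow_le_pow_left₀ (norm_nonneg _) (hb X) 2
    refine ⟨1 + K ^ 2, by positivity, fun X _ => ⟨?_, ?_⟩⟩
    · nlinarith [sq_nonneg ‖𝒜 X‖, mul_nonneg (sq_nonneg K) (sq_nonneg (frobNorm X))]
    · nlinarith [hb2 X, sq_nonneg (frobNorm X)]
  · rintro δ ⟨hδ, hX⟩
    refine ⟨hδ, fun x hx => ?_⟩
    rw [compression_apply, ← frobNorm_mul_diagonal h]
    exact hX _ ((rank_mul_diagonal_le U V x).trans hx)

theorem vecROC_compression_le {m n₁ n₂ : ℕ} (𝒜 : MeasOp m n₁ n₂)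
    {U : Matrix (Fin n₁) (Fin n₁) ℝ} {V : Matrix (Fin n₂) (Fin n₁) ℝ} (h : IsUnitaryPair U V)
    (k k' : ℕ) : vecROC (compression 𝒜 U V) k k' ≤ opROC 𝒜 k k' := by
  refine csInf_le_csInf ⟨0, fun _ h => h.1⟩ ?_ ?_
  · obtain ⟨K, hK, hb⟩ := exists_norm_le_mul_frobNorm 𝒜
    refine ⟨K * K, by positivity, fun X X' _ _ _ _ => ?_⟩
    refine (abs_real_inner_le_norm _ _).trans ?_
    calc ‖𝒜 X‖ * ‖𝒜 X'‖ ≤ (K * frobNorm X) * (K * frobNorm X') :=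
          mul_le_mul (hb X) (hb X') (norm_nonneg _) (mul_nonneg hK (frobNorm_nonneg X))
      _ = _ := by ring
  · rintro θ ⟨hθ, hX⟩
    refine ⟨hθ, fun x x' hx hx' hdisj => ?_⟩
    have hzero : diagonal x.ofLp * diagonal x'.ofLp = 0 := by
      rw [diagonal_mul_diagonal, ← diagonal_zero]
      congr 1
      ext i
      simpa using hdisj i
    rw [compression_apply, compression_apply, ← frobNorm_mul_diagonal h,
      ← frobNorm_mul_diagonal h x']
    refine hX _ _ ((rank_mul_diagonal_le U V x).trans hx) ((rank_mul_diagonal_le U V x').trans hx')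
      ?_ ?_
    · calc (U * diagonal x.ofLp * Vᵀ)ᵀ * (U * diagonal x'.ofLp * Vᵀ)
          = V * diagonal x.ofLp * (Uᵀ * U) * diagonal x'.ofLp * Vᵀ := by
            simp only [transpose_mul, diagonal_transpose, transpose_transpose, Matrix.mul_assoc]
        _ = V * (diagonal x.ofLp * diagonal x'.ofLp) * Vᵀ := by
            rw [h.1]; simp only [Matrix.mul_assoc, Matrix.mul_one]
        _ = 0 := by rw [hzero]; simp
    · calc (U * diagonal x.ofLp * Vᵀ) * (U * diagonal x'.ofLp * Vᵀ)ᵀ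
          = U * diagonal x.ofLp * (Vᵀ * V) * diagonal x'.ofLp * Uᵀ := by
            simp only [transpose_mul, diagonal_transpose, transpose_transpose, Matrix.mul_assoc]
        _ = U * (diagonal x.ofLp * diagonal x'.ofLp) * Uᵀ := by
            rw [h.2.2]; simp only [Matrix.mul_assoc, Matrix.mul_one]
        _ = 0 := by rw [hzero]; simp

theorem vecSatisfies_compression {m n₁ n₂ : ℕ} {F : Set RIPInequality} {𝒜 : MeasOp m n₁ n₂}
    (hF : OpSatisfies F 𝒜) {U : Matrix (Fin n₁) (Fin n₁) ℝ} {V : Matrix (Fin n₂) (Fin n₁) ℝ}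
    (h : IsUnitaryPair U V) : VecSatisfies F (compression 𝒜 U V) := fun I hI =>
  (I.mono _ _ _ _ (fun _ => vecRIC_nonneg _ _) (fun _ => vecRIC_compression_le 𝒜 h _)
    (fun _ => vecROC_nonneg _ _ _) (fun _ => vecROC_compression_le 𝒜 h _ _)).trans (hF I hI)

/-! ### Transfer of recovery guarantees from vectors to matrices -/

/-- A recovery instance for matrices yields a recovery instance for vectors with the same error
and tail norms, for a compression of the operator. -/
theorem exists_vector_instance {m n₁ n₂ : ℕ} (hn : n₁ ≤ n₂) {k : ℕ} {ε : ℝ} {𝒜 : MeasOp m n₁ n₂}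
    {X₀ X' Xk : Matrix (Fin n₁) (Fin n₂) ℝ} {z : Vec m} (hgood : MatAsGood 𝒜 ε (𝒜 X₀ + z) X₀ X')
    (hk : IsSVDTruncation X₀ k Xk) :
    ∃ (U : Matrix (Fin n₁) (Fin n₁) ℝ) (V : Matrix (Fin n₂) (Fin n₁) ℝ) (x₀ x' xk : Vec n₁),
      IsUnitaryPair U V ∧
      VecAsGood (compression 𝒜 U V) ε ((compression 𝒜 U V).toEuclideanLin x₀ + z) x₀ x' ∧
      IsTopRestriction x₀ k xk ∧ ‖x₀ - x'‖ = frobNorm (X₀ - X') ∧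
      l1Norm (x₀ - x') = nuclearNorm (X₀ - X') ∧ l1Norm (x₀ - xk) = nuclearNorm (X₀ - Xk) := by
  -- The singular vectors are those of the error, so that the compression maps `σ(X₀ - X')` exactly
  -- to `𝒜 X₀ - 𝒜 X'`.
  obtain ⟨U, V, hUV, hW⟩ := exists_svd hn (X₀ - X')
  let w : Vec n₁ := WithLp.toLp 2 fun i => sigma (X₀ - X') i
  let x₀ : Vec n₁ := WithLp.toLp 2 fun i => sigma X₀ i
  let xk : Vec n₁ := WithLp.toLp 2 fun i => if (i : ℕ) < k then sigma X₀ i else 0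
  have hw : x₀ - (x₀ - w) = w := sub_sub_cancel _ _
  refine ⟨U, V, x₀, x₀ - w, xk, hUV, ⟨?_, ?_⟩, ?_, ?_, ?_, ?_⟩
  · have h1 : (compression 𝒜 U V).toEuclideanLin w = 𝒜 X₀ - 𝒜 X' := by
      rw [compression_apply, ← map_sub]
      exact congrArg 𝒜 hW.symm
    have h2 : (compression 𝒜 U V).toEuclideanLin (x₀ - w) -
        ((compression 𝒜 U V).toEuclideanLin x₀ + z) = 𝒜 X' - (𝒜 X₀ + z) := by
      rw [map_sub, h1]
      abel
    rw [h2]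
    exact hgood.1
  · calc l1Norm (x₀ - w) = ∑ i : Fin n₁, |sigma X₀ i - sigma (X₀ - X') i| := rfl
      _ ≤ nuclearNorm (X₀ - (X₀ - X')) := sum_abs_sigma_sub_le hn _ _
      _ = nuclearNorm X' := by rw [sub_sub_cancel]
      _ ≤ nuclearNorm X₀ := hgood.2
      _ = l1Norm x₀ := Finset.sum_congr rfl fun i _ => (abs_of_nonneg (sigma_nonneg _ _)).symm
  · refine ⟨Finset.univ.filter fun i => (i : ℕ) < k, ?_, ?_, ?_⟩
    · rw [Fin.card_filter_val_lt, min_comm]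
    · intro i hi j hj
      simp only [Finset.mem_filter, Finset.mem_univ, true_and, not_lt] at hi hj
      change |sigma X₀ j| ≤ |sigma X₀ i|
      rw [abs_of_nonneg (sigma_nonneg _ _), abs_of_nonneg (sigma_nonneg _ _)]
      exact sigma_antitone X₀ (by omega)
    · intro i
      simp [xk, x₀]
  · rw [hw, ← frobNorm_mul_diagonal hUV]
    exact congrArg frobNorm hW.symm
  · rw [hw]
    exact Finset.sum_congr rfl fun i _ => abs_of_nonneg (sigma_nonneg _ _)
  · obtain ⟨U', V', hUV', hX, hXk⟩ := hk
    have h1 : X₀ - Xk = U' * diagonal (fun i : Fin n₁ => if (i : ℕ) < k then 0 else sigma X₀ i) *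
        V'ᵀ := by
      conv_lhs => rw [hXk]; enter [1]; rw [hX]
      rw [← Matrix.sub_mul, ← Matrix.mul_sub, diagonal_sub]
      congr 3
      ext i
      split_ifs <;> simp
    rw [h1, nuclearNorm_mul_diagonal hn hUV']
    · refine Finset.sum_congr rfl fun i _ => ?_
      simp only [x₀, xk, PiLp.sub_apply]
      split_ifs
      · simp
      · simp [abs_of_nonneg (sigma_nonneg X₀ i)]
    · intro i
      split_ifs
      · exact le_rfl
      · exact sigma_nonneg _ _

theorem matFrobRobust_of_vecL2Robust {m n₁ n₂ k : ℕ} (hn : n₁ ≤ n₂) {F : Set RIPInequality}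
    {ε C₁ C₂ : ℝ}
    (h : ∀ A : Matrix (Fin m) (Fin n₁) ℝ, VecSatisfies F A → VecL2Robust A k ε C₁ C₂)
    {𝒜 : MeasOp m n₁ n₂} (hF : OpSatisfies F 𝒜) : MatFrobRobust 𝒜 k ε C₁ C₂ := by
  intro X₀ X' Xk z hz hgood hk
  obtain ⟨U, V, x₀, x', xk, hUV, hg, ht, h1, -, h3⟩ := exists_vector_instance hn hgood hk
  rw [← h1, ← h3]
  exact h _ (vecSatisfies_compression hF hUV) x₀ x' xk z hz hg ht

theorem matNuclearRobust_of_vecL1Robust {m n₁ n₂ k : ℕ} (hn : n₁ ≤ n₂) {F : Set RIPInequality}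
    {ε C₃ : ℝ}
    (h : ∀ A : Matrix (Fin m) (Fin n₁) ℝ, VecSatisfies F A → VecL1Robust A k ε C₃)
    {𝒜 : MeasOp m n₁ n₂} (hF : OpSatisfies F 𝒜) : MatNuclearRobust 𝒜 k ε C₃ := by
  intro X₀ X' Xk z hz hgood hk
  obtain ⟨U, V, x₀, x', xk, hUV, hg, ht, -, h2, h3⟩ := exists_vector_instance hn hgood hk
  rw [← h2, ← h3]
  exact h _ (vecSatisfies_compression hF hUV) x₀ x' xk z hz hg ht

/-! ### Convex combinations of indicator functions -/

/-- `w` is a convex combination of indicator functions of sets with at most `s` elements. -/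
def IsIndicatorCombination {ι : Type*} [Fintype ι] [DecidableEq ι] (s : ℕ) (w : ι → ℝ) : Prop :=
  ∃ c : Finset ι → ℝ, (∀ S, 0 ≤ c S) ∧ ∑ S, c S = 1 ∧ (∀ S, c S ≠ 0 → S.card ≤ s) ∧
    ∀ i, ∑ S, c S * (if i ∈ S then 1 else 0) = w i

theorem IsIndicatorCombination.combo {ι : Type*} [Fintype ι] [DecidableEq ι] {s : ℕ}
    {w w₁ w₂ : ι → ℝ} (h₁ : IsIndicatorCombination s w₁) (h₂ : IsIndicatorCombination s w₂)
    {t : ℝ} (ht0 : 0 ≤ t) (ht1 : t ≤ 1) (hw : ∀ i, w i = t * w₁ i + (1 - t) * w₂ i) :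
    IsIndicatorCombination s w := by
  obtain ⟨c₁, hc₁, hs₁, hk₁, hi₁⟩ := h₁
  obtain ⟨c₂, hc₂, hs₂, hk₂, hi₂⟩ := h₂
  refine ⟨fun S => t * c₁ S + (1 - t) * c₂ S, fun S => ?_, ?_, fun S hS => ?_, fun i => ?_⟩
  · exact add_nonneg (mul_nonneg ht0 (hc₁ S)) (mul_nonneg (sub_nonneg.mpr ht1) (hc₂ S))
  · rw [Finset.sum_add_distrib, ← Finset.mul_sum, ← Finset.mul_sum, hs₁, hs₂]
    ring
  · by_cases h : c₁ S = 0
    · refine hk₂ S fun h' => hS ?_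
      simp [h, h']
    · exact hk₁ S h
  · simp only [add_mul, mul_assoc]
    rw [Finset.sum_add_distrib, ← Finset.mul_sum, ← Finset.mul_sum, hi₁, hi₂, hw]

/-- The sum is an integer, so `< s + 1` suffices. This slack permits rounding a single fractional
coordinate up to 1. -/
theorem isIndicatorCombination_of_zero_or_one {ι : Type*} [Fintype ι] [DecidableEq ι] {s : ℕ}
    {w : ι → ℝ} (h : ∀ i, w i = 0 ∨ w i = 1) (hs : ∑ i, w i < s + 1) :
    IsIndicatorCombination s w := by
  classical
  set T : Finset ι := Finset.univ.filter fun i => w i = 1 with hT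
  have hw : ∀ i, w i = if i ∈ T then 1 else 0 := by
    intro i
    rcases h i with h0 | h1
    · simp [hT, h0]
    · simp [hT, h1]
  refine ⟨Pi.single T 1, fun S => ?_, ?_, fun S hS => ?_, fun i => ?_⟩
  · by_cases hST : S = T
    · subst hST; simp
    · simp [hST]
  · simp
  · have hST : S = T := by
      by_contra hne
      exact hS (by simp [hne])
    have hsum : ∑ i, w i = T.card := by
      simp only [hw]
      simp
    rw [hsum] at hs
    rw [hST]
    exact_mod_cast Nat.lt_succ_iff.mp (by exact_mod_cast hs)
  · rw [hw, Finset.sum_eq_single T]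
    · simp
    · intro S _ hS
      simp [hS]
    · simp

/-- Moving weight from `j` to `i` until one of them is no longer fractional. -/
theorem card_fractional_transfer_lt {ι : Type*} [Fintype ι] [DecidableEq ι] {w : ι → ℝ}
    (h0 : ∀ i, 0 ≤ w i) (h1 : ∀ i, w i ≤ 1) {i j : ι} (hij : i ≠ j) (hi0 : 0 < w i)
    (hi1 : w i < 1) (hj0 : 0 < w j) (hj1 : w j < 1) :
    ∃ a : ℝ, 0 < a ∧ ∃ w' : ι → ℝ, w' = w + a • (Pi.single i 1 - Pi.single j 1) ∧
      (∀ l, 0 ≤ w' l) ∧ (∀ l, w' l ≤ 1) ∧ ∑ l, w' l = ∑ l, w l ∧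
      (Finset.univ.filter fun l => 0 < w' l ∧ w' l < 1).card <
        (Finset.univ.filter fun l => 0 < w l ∧ w l < 1).card := by
  have hji := hij.symm
  -- The largest admissible shift: `w i` reaches 1 or `w j` reaches 0.
  refine ⟨min (1 - w i) (w j), lt_min (by linarith) hj0, _, rfl, ?_⟩
  set a := min (1 - w i) (w j) with ha
  have ha0 : 0 < a := lt_min (by linarith) hj0
  have ha1 : a ≤ 1 - w i := min_le_left _ _
  have ha2 : a ≤ w j := min_le_right _ _
  set w' : ι → ℝ := w + a • (Pi.single i 1 - Pi.single j 1) with hw'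
  have hwi : w' i = w i + a := by simp [hw', hij]
  have hwj : w' j = w j - a := by simp [hw', hji]; ring
  have hwl : ∀ l, l ≠ i → l ≠ j → w' l = w l := fun l hli hlj => by simp [hw', hli, hlj]
  refine ⟨fun l => ?_, fun l => ?_, ?_, ?_⟩
  · by_cases hli : l = i
    · subst hli; rw [hwi]; linarith
    · by_cases hlj : l = j
      · subst hlj; rw [hwj]; linarith
      · rw [hwl l hli hlj]; exact h0 l
  · by_cases hli : l = i
    · subst hli; rw [hwi]; linarith
    · by_cases hlj : l = j
      · subst hlj; rw [hwj]; linarith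
      · rw [hwl l hli hlj]; exact h1 l
  · simp [hw', Finset.sum_add_distrib, ← Finset.mul_sum]
  · refine Finset.card_lt_card ⟨fun l hl => ?_, fun hsub => ?_⟩
    · simp only [Finset.mem_filter, Finset.mem_univ, true_and] at hl ⊢
      by_cases hli : l = i
      · subst hli; exact ⟨hi0, hi1⟩
      · by_cases hlj : l = j
        · subst hlj; exact ⟨hj0, hj1⟩
        · rwa [hwl l hli hlj] at hl
    · have hi' := hsub (Finset.mem_filter.mpr ⟨Finset.mem_univ i, hi0, hi1⟩)
      have hj' := hsub (Finset.mem_filter.mpr ⟨Finset.mem_univ j, hj0, hj1⟩)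
      simp only [Finset.mem_filter, Finset.mem_univ, true_and, hwi, hwj] at hi' hj'
      rcases min_choice (1 - w i) (w j) with h | h
      · linarith [hi'.2, ha.trans h]
      · linarith [hj'.1, ha.trans h]

/-- The hypersimplex is the convex hull of its integral points. -/
theorem isIndicatorCombination {ι : Type*} [Fintype ι] [DecidableEq ι] {s : ℕ} (w : ι → ℝ)
    (h0 : ∀ i, 0 ≤ w i) (h1 : ∀ i, w i ≤ 1) (hs : ∑ i, w i ≤ s) :
    IsIndicatorCombination s w := by
  induction hN : (Finset.univ.filter fun l => 0 < w l ∧ w l < 1).card using Nat.strong_induction_on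
    generalizing w with
  | _ N ih =>
  subst hN
  by_cases hfrac : ∃ i, 0 < w i ∧ w i < 1
  · obtain ⟨i, hi0, hi1⟩ := hfrac
    by_cases hfrac2 : ∃ j, i ≠ j ∧ 0 < w j ∧ w j < 1
    · obtain ⟨j, hij, hj0, hj1⟩ := hfrac2
      obtain ⟨a, ha, w₁, hw₁, h10, h11, h1s, h1c⟩ :=
        card_fractional_transfer_lt h0 h1 hij hi0 hi1 hj0 hj1
      obtain ⟨b, hb, w₂, hw₂, h20, h21, h2s, h2c⟩ :=
        card_fractional_transfer_lt h0 h1 hij.symm hj0 hj1 hi0 hi1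
      -- The shifts by `a` and by `b` go in opposite directions; weights `b / (a + b)` and `a / (a +
      -- b)` cancel them.
      refine (ih _ h1c w₁ h10 h11 (h1s.le.trans hs) rfl).combo
        (ih _ h2c w₂ h20 h21 (h2s.le.trans hs) rfl) (t := b / (a + b)) (by positivity)
        ((div_le_one (by positivity)).mpr (by linarith)) fun l => ?_
      rw [hw₁, hw₂]
      simp only [Pi.add_apply, Pi.smul_apply, Pi.sub_apply, smul_eq_mul]
      field_simp
      ring
    · push Not at hfrac2
      have hint : ∀ l, l ≠ i → w l = 0 ∨ w l = 1 := by
        intro l hl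
        rcases (h0 l).eq_or_lt with h | h
        · exact Or.inl h.symm
        · exact Or.inr (le_antisymm (h1 l) (hfrac2 l hl.symm h))
      have hupd : ∀ t : ℝ, (t = 0 ∨ t = 1) → ∀ l, Function.update w i t l = 0 ∨
          Function.update w i t l = 1 := by
        intro t ht l
        by_cases hl : l = i
        · subst hl; simpa using ht
        · simpa [hl] using hint l hl
      have hsumupd : ∀ t : ℝ, ∑ l, Function.update w i t l = ∑ l, w l - w i + t := by
        intro t
        rw [Finset.sum_update_of_mem (Finset.mem_univ i), Finset.sdiff_singleton_eq_erase,
          Finset.sum_erase_eq_sub (Finset.mem_univ i)]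
        ring
      refine (isIndicatorCombination_of_zero_or_one (hupd 1 (Or.inr rfl))
        (by rw [hsumupd]; linarith)).combo (isIndicatorCombination_of_zero_or_one
        (hupd 0 (Or.inl rfl)) (by rw [hsumupd]; linarith)) (t := w i) hi0.le hi1.le fun l => ?_
      by_cases hl : l = i
      · subst hl; simp
      · simp only [Function.update_of_ne hl]
        ring
  · push Not at hfrac
    refine isIndicatorCombination_of_zero_or_one (fun i => ?_) (by linarith)
    rcases (h0 i).eq_or_lt with h | h
    · exact Or.inl h.symm
    · exact Or.inr (le_antisymm (h1 i) (hfrac i h))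

/-! ### Consequences for measurement matrices -/

/-- The restriction of `g` to the coordinates in `S`. -/
def mask {n : ℕ} (S : Finset (Fin n)) (g : Vec n) : Vec n :=
  WithLp.toLp 2 fun i => if i ∈ S then g i else 0

theorem mask_apply {n : ℕ} (S : Finset (Fin n)) (g : Vec n) (i : Fin n) :
    mask S g i = if i ∈ S then g i else 0 := rfl

theorem norm_sq_vec {n : ℕ} (x : Vec n) : ‖x‖ ^ 2 = ∑ i, x i ^ 2 := by
  simp [EuclideanSpace.norm_sq_eq]

theorem norm_mask_sq {n : ℕ} (S : Finset (Fin n)) (g : Vec n) :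
    ‖mask S g‖ ^ 2 = ∑ i, (if i ∈ S then 1 else 0) * g i ^ 2 := by
  rw [norm_sq_vec]
  refine Finset.sum_congr rfl fun i _ => ?_
  rw [mask_apply]
  split_ifs <;> simp

theorem nnzCount_mask_le {n : ℕ} (S : Finset (Fin n)) (g : Vec n) :
    nnzCount (mask S g) ≤ S.card := by
  refine Finset.card_le_card fun i hi => ?_
  by_contra hS
  simp [mask_apply, hS] at hi

/-- A bound for a linear functional on sparse vectors extends to weighted vectors `w • g`. -/
theorem abs_le_of_sparse_bound {n : ℕ} (s : ℕ) (f : Vec n →ₗ[ℝ] ℝ) {θ : ℝ} (hθ : 0 ≤ θ)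
    (g : Vec n) (hf : ∀ x, nnzCount x ≤ s → (∀ i, g i = 0 → x i = 0) → |f x| ≤ θ * ‖x‖)
    (w : Fin n → ℝ) (h0 : ∀ i, 0 ≤ w i) (h1 : ∀ i, w i ≤ 1) (hs : ∑ i, w i ≤ s) (y : Vec n)
    (hy : ∀ i, y i = w i * g i) : |f y| ≤ θ * √(∑ i, w i * g i ^ 2) := by
  obtain ⟨c, hc0, hc1, hcs, hcw⟩ := isIndicatorCombination w h0 h1 hs
  have hyc : y = ∑ S, c S • mask S g := by
    ext i
    rw [hy, ← hcw, Finset.sum_mul, WithLp.ofLp_sum, Finset.sum_apply]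
    refine Finset.sum_congr rfl fun S _ => ?_
    simp only [PiLp.smul_apply, mask_apply, smul_eq_mul]
    split_ifs <;> simp
  have hfy : |f y| ≤ θ * ∑ S, c S * ‖mask S g‖ := by
    rw [hyc, map_sum, Finset.mul_sum]
    refine (Finset.abs_sum_le_sum_abs _ _).trans (Finset.sum_le_sum fun S _ => ?_)
    rw [map_smul, smul_eq_mul, abs_mul, abs_of_nonneg (hc0 S)]
    by_cases hS : c S = 0
    · simp [hS]
    · have := hf (mask S g) ((nnzCount_mask_le S g).trans (hcs S hS)) fun i hi => by
        simp [mask_apply, hi]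
      calc c S * |f (mask S g)| ≤ c S * (θ * ‖mask S g‖) :=
            mul_le_mul_of_nonneg_left this (hc0 S)
        _ = θ * (c S * ‖mask S g‖) := by ring
  -- Squared norms of masks are linear in the indicator, so they average exactly; Jensen's
  -- inequality then bounds the average of the norms.
  have hsq : ∑ S, c S * ‖mask S g‖ ^ 2 = ∑ i, w i * g i ^ 2 := by
    simp only [norm_mask_sq, Finset.mul_sum, ← hcw, Finset.sum_mul]
    rw [Finset.sum_comm]
    simp only [mul_assoc]
  have hjensen : (∑ S, c S * ‖mask S g‖) ^ 2 ≤ ∑ i, w i * g i ^ 2 := by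
    rw [← hsq]
    set μ := ∑ S, c S * ‖mask S g‖ with hμ
    have : 0 ≤ ∑ S, c S * (‖mask S g‖ - μ) ^ 2 :=
      Finset.sum_nonneg fun S _ => mul_nonneg (hc0 S) (sq_nonneg _)
    have hexp : ∀ r : ℝ, ∑ S, c S * (‖mask S g‖ - r) ^ 2 =
        ∑ S, c S * ‖mask S g‖ ^ 2 - 2 * r * ∑ S, c S * ‖mask S g‖ + r ^ 2 * ∑ S, c S := by
      intro r
      rw [Finset.mul_sum, Finset.mul_sum, ← Finset.sum_sub_distrib, ← Finset.sum_add_distrib]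
      refine Finset.sum_congr rfl fun S _ => ?_
      ring
    rw [hexp, hc1, ← hμ] at this
    nlinarith
  exact hfy.trans (mul_le_mul_of_nonneg_left (Real.le_sqrt_of_sq_le hjensen) hθ)

/-- `θ` bounds the restricted orthogonality constant `θ_{k,k'}` of `A`. -/
def OrthoBound {m n : ℕ} (A : Matrix (Fin m) (Fin n) ℝ) (k k' : ℕ) (θ : ℝ) : Prop :=
  ∀ x y : Vec n, nnzCount x ≤ k → nnzCount y ≤ k' → (∀ i, x i = 0 ∨ y i = 0) →
    |inner ℝ (A.toEuclideanLin x) (A.toEuclideanLin y)| ≤ θ * ‖x‖ * ‖y‖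

/-- `δ` bounds the restricted isometry constant `δ_k` of `A`. -/
def IsometryBound {m n : ℕ} (A : Matrix (Fin m) (Fin n) ℝ) (k : ℕ) (δ : ℝ) : Prop :=
  ∀ x : Vec n, nnzCount x ≤ k → (1 - δ) * ‖x‖ ^ 2 ≤ ‖A.toEuclideanLin x‖ ^ 2 ∧
    ‖A.toEuclideanLin x‖ ^ 2 ≤ (1 + δ) * ‖x‖ ^ 2

/-- Some admissible constant lies below `δ`, and admissibility passes to larger constants, so
attainment of the infimum is not needed. -/
theorem isometryBound_of_vecRIC_lt {m n : ℕ} {A : Matrix (Fin m) (Fin n) ℝ} {k : ℕ} {δ : ℝ}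
    (h : vecRIC A k < δ) : IsometryBound A k δ := by
  have hne : {δ : ℝ | 0 ≤ δ ∧ ∀ x : Vec n, nnzCount x ≤ k →
      (1 - δ) * ‖x‖ ^ 2 ≤ ‖A.toEuclideanLin x‖ ^ 2 ∧
      ‖A.toEuclideanLin x‖ ^ 2 ≤ (1 + δ) * ‖x‖ ^ 2}.Nonempty := by
    set K := ‖LinearMap.toContinuousLinearMap A.toEuclideanLin‖ with hK
    have hb : ∀ x, ‖A.toEuclideanLin x‖ ^ 2 ≤ K ^ 2 * ‖x‖ ^ 2 := fun x => by
      rw [← mul_pow]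
      exact pow_le_pow_left₀ (norm_nonneg _)
        ((LinearMap.toContinuousLinearMap A.toEuclideanLin).le_opNorm x) 2
    refine ⟨1 + K ^ 2, by positivity, fun x _ => ⟨?_, ?_⟩⟩
    · nlinarith [sq_nonneg ‖A.toEuclideanLin x‖, mul_nonneg (sq_nonneg K) (sq_nonneg ‖x‖)]
    · nlinarith [hb x, sq_nonneg ‖x‖]
  obtain ⟨δ', ⟨-, hδ'⟩, hlt⟩ := exists_lt_of_csInf_lt hne h
  intro x hx
  obtain ⟨h1, h2⟩ := hδ' x hx
  constructor <;> nlinarith [sq_nonneg ‖x‖]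

theorem nnzCount_smul_le {n : ℕ} (c : ℝ) (x : Vec n) : nnzCount (c • x) ≤ nnzCount x := by
  refine Finset.card_le_card fun i hi => ?_
  have hi' : c * x i ≠ 0 := (Finset.mem_filter.mp hi).2
  exact Finset.mem_filter.mpr ⟨Finset.mem_univ i, right_ne_zero_of_mul hi'⟩

theorem nnzCount_add_le {n : ℕ} (x y : Vec n) : nnzCount (x + y) ≤ nnzCount x + nnzCount y := by
  classical
  refine le_trans (Finset.card_le_card fun i hi => ?_) (Finset.card_union_le _ _)
  have hi' : x i + y i ≠ 0 := (Finset.mem_filter.mp hi).2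
  simp only [Finset.mem_filter, Finset.mem_univ, true_and, Finset.mem_union]
  by_contra! hcon
  exact hi' (by simp [hcon.1, hcon.2])

/-- Polarization: `4⟨Ax, Ay⟩ = ‖A(x+y)‖² - ‖A(x-y)‖²`, and `‖x ± y‖² = ‖x‖² + ‖y‖²` for disjoint
supports. Rescaling to equal norms turns the sum of squares into a product. -/
theorem IsometryBound.orthoBound {m n : ℕ} {A : Matrix (Fin m) (Fin n) ℝ} {k p q : ℕ} {δ : ℝ}
    (h : IsometryBound A k δ) (hpq : p + q ≤ k) : OrthoBound A p q δ := by
  have key : ∀ x y : Vec n, nnzCount x ≤ p → nnzCount y ≤ q → (∀ i, x i = 0 ∨ y i = 0) →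
      4 * inner ℝ (A.toEuclideanLin x) (A.toEuclideanLin y) ≤ 2 * δ * (‖x‖ ^ 2 + ‖y‖ ^ 2) := by
    intro x y hx hy hd
    have hxy : inner ℝ x y = 0 := by
      rw [inner_vec]
      refine Finset.sum_eq_zero fun i _ => ?_
      rcases hd i with h | h <;> simp [h]
    have hneg : nnzCount (-y) ≤ q := by
      have := nnzCount_smul_le (-1) y
      rw [neg_one_smul] at this
      omega
    have h1 := (h (x + y) (by have := nnzCount_add_le x y; omega)).2
    have h2 := (h (x - y) (by
      have := nnzCount_add_le x (-y)
      rw [← sub_eq_add_neg] at this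
      omega)).1
    rw [map_add, norm_add_sq_real, norm_add_sq_real, hxy] at h1
    rw [map_sub, norm_sub_sq_real, norm_sub_sq_real, hxy] at h2
    linarith
  intro x y hx hy hd
  by_cases hx0 : x = 0
  · simp [hx0]
  by_cases hy0 : y = 0
  · simp [hy0]
  have hxp : 0 < ‖x‖ := norm_pos_iff.mpr hx0
  have hyp : 0 < ‖y‖ := norm_pos_iff.mpr hy0
  have hpp : 0 < ‖x‖ * ‖y‖ := mul_pos hxp hyp
  have k1 := key (‖y‖ • x) (‖x‖ • y) ((nnzCount_smul_le _ _).trans hx)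
    ((nnzCount_smul_le _ _).trans hy) fun i => by
      rcases hd i with h | h
      · left; simp [h]
      · right; simp [h]
  have k2 := key (‖y‖ • x) (-‖x‖ • y) ((nnzCount_smul_le _ _).trans hx)
    ((nnzCount_smul_le _ _).trans hy) fun i => by
      rcases hd i with h | h
      · left; simp [h]
      · right; simp [h]
  simp only [map_smul, inner_smul_left, inner_smul_right, norm_smul, norm_neg, norm_norm,
    conj_trivial] at k1 k2
  rw [abs_le]
  constructor
  · refine le_of_mul_le_mul_left ?_ hpp
    nlinarith
  · refine le_of_mul_le_mul_left ?_ hpp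
    nlinarith

theorem OrthoBound.symm {m n : ℕ} {A : Matrix (Fin m) (Fin n) ℝ} {k k' : ℕ} {θ : ℝ}
    (h : OrthoBound A k k' θ) : OrthoBound A k' k θ := fun x y hx hy hd => by
  rw [real_inner_comm, mul_right_comm]
  exact h y x hy hx fun i => (hd i).symm

/-- Averaging over the `p`-element subsets of a support of size `k`. -/
theorem OrthoBound.enlarge {m n : ℕ} {A : Matrix (Fin m) (Fin n) ℝ} {p k q : ℕ} {θ : ℝ}
    (hθ : 0 ≤ θ) (hp : 0 < p) (hpk : p ≤ k) (h : OrthoBound A p q θ) :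
    OrthoBound A k q (√(k / p) * θ) := by
  intro x y hx hy hd
  have hp' : (0 : ℝ) < p := by exact_mod_cast hp
  have hpk' : (p : ℝ) ≤ k := by exact_mod_cast hpk
  have hk' : (0 : ℝ) < k := hp'.trans_le hpk'
  let f : Vec n →ₗ[ℝ] ℝ := (innerₛₗ ℝ (A.toEuclideanLin y)).comp A.toEuclideanLin
  have hf : ∀ v, f v = inner ℝ (A.toEuclideanLin v) (A.toEuclideanLin y) := fun v => by
    rw [real_inner_comm]
    rfl
  -- Weight `p / k` on a support of at most `k` points has total at most `p`. The bound for `(p / k)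
  -- x` gains `√(p / k)`, and division by `p / k` leaves `√(k / p)`.
  let w : Fin n → ℝ := fun i => if x i = 0 then 0 else p / k
  have hw : ∀ i, w i * x i = p / k * x i := fun i => by
    simp only [w]; split_ifs with h0 <;> simp [h0]
  have hmain := abs_le_of_sparse_bound p f (mul_nonneg hθ (norm_nonneg y)) x
    (fun v hv hvx => by
      rw [hf]
      calc _ ≤ θ * ‖v‖ * ‖y‖ := h v y hv hy fun i => (hd i).imp_left (hvx i)
        _ = _ := by ring) w
    (fun i => by simp only [w]; split_ifs <;> positivity)
    (fun i => by
      simp only [w]; split_ifs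
      · exact zero_le_one
      · exact (div_le_one hk').mpr hpk')
    (by
      have : ∑ i, w i = nnzCount x * (p / k : ℝ) := by
        simp only [w, nnzCount]
        rw [Finset.sum_ite]
        simp
      rw [this]
      calc (nnzCount x : ℝ) * (p / k) ≤ k * (p / k) := by gcongr
        _ = p := by field_simp)
    ((p / k : ℝ) • x) (fun i => by rw [hw]; rfl)
  have hsum : ∑ i, w i * x i ^ 2 = (p / k) * ‖x‖ ^ 2 := by
    rw [norm_sq_vec, Finset.mul_sum]
    refine Finset.sum_congr rfl fun i _ => ?_
    rw [sq, ← mul_assoc, hw, mul_assoc]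
  rw [hsum, Real.sqrt_mul (by positivity), Real.sqrt_sq (norm_nonneg x), map_smul, smul_eq_mul,
    abs_mul, abs_of_nonneg (by positivity : (0 : ℝ) ≤ p / k), hf] at hmain
  have hsq : √(p / k : ℝ) = (p / k) * √(k / p : ℝ) := by
    rw [Real.sqrt_eq_iff_mul_self_eq (by positivity) (by positivity)]
    rw [mul_mul_mul_comm, Real.mul_self_sqrt (by positivity)]
    field_simp
  rw [hsq] at hmain
  refine le_of_mul_le_mul_left (hmain.trans (le_of_eq ?_)) (by positivity : (0 : ℝ) < p / k)
  ring

/-! ### Robust recovery of vectors -/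

/-- A set of coordinates on which `h` is largest. -/
theorem exists_top_set {n : ℕ} (h : Vec n) {r : ℕ} (hr : r ≤ n) :
    ∃ T : Finset (Fin n), T.card = r ∧ (∀ i ∈ T, ∀ j ∉ T, |h j| ≤ |h i|) ∧
      ∀ S : Finset (Fin n), S.card = r → ∑ i ∈ S, |h i| ≤ ∑ i ∈ T, |h i| := by
  have hne : (Finset.powersetCard r (Finset.univ : Finset (Fin n))).Nonempty :=
    Finset.powersetCard_nonempty.mpr (by simpa using hr)
  obtain ⟨T, hT, hmax⟩ := Finset.exists_max_image _ (fun S => ∑ i ∈ S, |h i|) hne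
  have hTr : T.card = r := (Finset.mem_powersetCard.mp hT).2
  have hmax' : ∀ S : Finset (Fin n), S.card = r → ∑ i ∈ S, |h i| ≤ ∑ i ∈ T, |h i| := fun S hS =>
    hmax S (Finset.mem_powersetCard.mpr ⟨Finset.subset_univ S, hS⟩)
  refine ⟨T, hTr, fun i hi j hj => ?_, hmax'⟩
  -- Exchanging `i` for `j` cannot increase the maximal sum.
  have hj' : j ∉ T.erase i := fun hmem => hj (Finset.mem_of_mem_erase hmem)
  have := hmax' (insert j (T.erase i)) (by
    rw [Finset.card_insert_of_notMem hj', Finset.card_erase_of_mem hi, hTr]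
    have : 0 < T.card := Finset.card_pos.mpr ⟨i, hi⟩
    omega)
  rw [Finset.sum_insert hj', Finset.sum_erase_eq_sub hi] at this
  linarith

/-- The error of a vector that is as good as `x₀` is concentrated on any set that carries most of
its mass. -/
theorem sum_compl_le_of_l1Norm_le {n k : ℕ} {x₀ x' xk : Vec n} (hle : l1Norm x' ≤ l1Norm x₀)
    (hk : IsTopRestriction x₀ k xk) {T : Finset (Fin n)}
    (hT : ∀ S : Finset (Fin n), S.card = min k n →
      ∑ i ∈ S, |(x₀ - x') i| ≤ ∑ i ∈ T, |(x₀ - x') i|) :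
    ∑ i ∈ Tᶜ, |(x₀ - x') i| ≤ ∑ i ∈ T, |(x₀ - x') i| + 2 * l1Norm (x₀ - xk) := by
  obtain ⟨S, hS, -, hxk⟩ := hk
  have htail : l1Norm (x₀ - xk) = ∑ i ∈ Sᶜ, |x₀ i| := by
    rw [l1Norm, ← Finset.sum_add_sum_compl S, Finset.sum_eq_zero, zero_add]
    · refine Finset.sum_congr rfl fun i hi => ?_
      simp [hxk, Finset.mem_compl.mp hi]
    · intro i hi
      simp [hxk, hi]
  -- Triangle inequality on `S` and on its complement, summed against `‖x'‖₁ ≤ ‖x₀‖₁`. Replacing `S`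
  -- by the heavier `T` only helps.
  have h1 : ∑ i ∈ S, (|x₀ i| - |(x₀ - x') i|) ≤ ∑ i ∈ S, |x' i| :=
    Finset.sum_le_sum fun i _ => by
      have := abs_sub_abs_le_abs_sub (x₀ i) (x' i)
      simp only [PiLp.sub_apply]
      linarith
  have h2 : ∑ i ∈ Sᶜ, (|(x₀ - x') i| - |x₀ i|) ≤ ∑ i ∈ Sᶜ, |x' i| :=
    Finset.sum_le_sum fun i _ => by
      have := abs_sub (x₀ i) (x' i)
      simp only [PiLp.sub_apply]
      linarith
  rw [Finset.sum_sub_distrib] at h1 h2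
  rw [l1Norm, l1Norm, ← Finset.sum_add_sum_compl S, ← Finset.sum_add_sum_compl S] at hle
  have h3 := hT S hS
  have h4 := Finset.sum_add_sum_compl S fun i => |(x₀ - x') i|
  have h5 := Finset.sum_add_sum_compl T fun i => |(x₀ - x') i|
  rw [htail]
  linarith

/-- A bound for the measurements of the part of `h` outside of `T`, when it is flat. -/
theorem OrthoBound.abs_inner_mask_compl_le {m n k : ℕ} {A : Matrix (Fin m) (Fin n) ℝ} {θ : ℝ}
    (hθ : 0 ≤ θ) (hA : OrthoBound A k k θ) (h : Vec n) {T : Finset (Fin n)} (hT : T.card ≤ k)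
    {α : ℝ} (hα : 0 ≤ α) (hle : ∀ i ∉ T, |h i| ≤ α) (hsum : ∑ i ∈ Tᶜ, |h i| ≤ k * α) :
    |inner ℝ (A.toEuclideanLin (mask Tᶜ h)) (A.toEuclideanLin (mask T h))| ≤
      θ * ‖mask T h‖ * (√k * α) := by
  rcases hα.eq_or_lt with h0 | hpos
  · have : mask Tᶜ h = 0 := by
      ext i
      by_cases hi : i ∈ T
      · simp [mask_apply, hi]
      · have := hle i hi
        rw [← h0] at this
        simp [mask_apply, abs_nonpos_iff.mp this]
    rw [this, ← h0]
    simp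
  let f : Vec n →ₗ[ℝ] ℝ :=
    (innerₛₗ ℝ (A.toEuclideanLin (mask T h))).comp A.toEuclideanLin
  have hf : ∀ v, f v = inner ℝ (A.toEuclideanLin v) (A.toEuclideanLin (mask T h)) := fun v => by
    rw [real_inner_comm]
    rfl
  -- Off `T`, `h = w • g` with entries of `g` in `{0, ±α}` and weights `|h| / α` of total at most
  -- `k`.
  let g : Vec n := mask Tᶜ (WithLp.toLp 2 fun i => α * SignType.sign (h i))
  let w : Fin n → ℝ := fun i => if i ∈ Tᶜ then |h i| / α else 0
  have hgT : ∀ i ∈ T, g i = 0 := fun i hi => by simp [g, mask_apply, hi]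
  have hwsum : ∑ i, w i = (∑ i ∈ Tᶜ, |h i|) / α := by
    simp only [w]
    rw [Finset.sum_ite_mem, Finset.univ_inter, Finset.sum_div]
  have hmain := abs_le_of_sparse_bound k f (mul_nonneg hθ (norm_nonneg (mask T h))) g
    (fun v hv hvg => by
      rw [hf]
      calc _ ≤ θ * ‖v‖ * ‖mask T h‖ := hA v _ hv ((nnzCount_mask_le T h).trans hT) fun i => by
            by_cases hi : i ∈ T
            · exact Or.inl (hvg i (hgT i hi))
            · exact Or.inr (by simp [mask_apply, hi])
        _ = _ := by ring) w
    (fun i => by simp only [w]; split_ifs <;> positivity)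
    (fun i => by
      simp only [w]; split_ifs with hi
      · exact (div_le_one hpos).mpr (hle i (Finset.mem_compl.mp hi))
      · exact zero_le_one)
    (by rw [hwsum, div_le_iff₀ hpos]; exact hsum)
    (mask Tᶜ h) (fun i => by
      simp only [w, g, mask_apply]
      split_ifs with hi
      · rw [← mul_assoc, div_mul_cancel₀ _ hpos.ne', mul_comm, sign_mul_abs]
      · simp)
  rw [hf] at hmain
  refine hmain.trans (mul_le_mul_of_nonneg_left ?_ (mul_nonneg hθ (norm_nonneg _)))
  have hs2 : ∑ i, w i * g i ^ 2 ≤ k * α ^ 2 := by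
    calc ∑ i, w i * g i ^ 2 ≤ ∑ i, w i * α ^ 2 := by
          refine Finset.sum_le_sum fun i _ => mul_le_mul_of_nonneg_left ?_ ?_
          · simp only [g, mask_apply]
            split_ifs
            · rw [mul_pow]
              refine mul_le_of_le_one_right (sq_nonneg α) ?_
              rcases SignType.trichotomy (SignType.sign (h i)) with e | e | e <;> simp [e]
            · simpa using sq_nonneg α
          · simp only [w]; split_ifs <;> positivity
      _ = (∑ i ∈ Tᶜ, |h i|) * α := by rw [← Finset.sum_mul, hwsum]; field_simp
      _ ≤ k * α * α := mul_le_mul_of_nonneg_right hsum hα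
      _ = k * α ^ 2 := by ring
  calc √(∑ i, w i * g i ^ 2) ≤ √(k * α ^ 2) := Real.sqrt_le_sqrt hs2
    _ = √k * α := by rw [Real.sqrt_mul (Nat.cast_nonneg k), Real.sqrt_sq hα]

/-- The error vector splits into a part `a` on at most `k` coordinates and a flat part `b`. -/
theorem error_bounds {m n k : ℕ} (hk : 1 ≤ k) {A : Matrix (Fin m) (Fin n) ℝ} {δ θ ε : ℝ}
    (hδ0 : 0 ≤ δ) (hθ : 0 ≤ θ) (hδθ : δ + θ ≤ 0.96) (hI : IsometryBound A k δ)
    (hO : OrthoBound A k k θ) {x₀ x' xk : Vec n} {z : Vec m} (hz : ‖z‖ ≤ ε)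
    (hgood : VecAsGood A ε (A.toEuclideanLin x₀ + z) x₀ x') (hxk : IsTopRestriction x₀ k xk) :
    ‖x₀ - x'‖ ≤ 102 / √k * l1Norm (x₀ - xk) + 200 * ε ∧
    l1Norm (x₀ - x') ≤ 102 * l1Norm (x₀ - xk) + 200 * √k * ε := by
  set h := x₀ - x' with hh
  set σ := l1Norm (x₀ - xk) with hσ
  have hσ0 : 0 ≤ σ := Finset.sum_nonneg fun i _ => abs_nonneg _
  have hε : 0 ≤ ε := (norm_nonneg z).trans hz
  have hkpos : (0 : ℝ) < k := by exact_mod_cast hk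
  have hsk : 0 < √(k : ℝ) := Real.sqrt_pos.mpr hkpos
  have hskk : √(k : ℝ) * √(k : ℝ) = k := Real.mul_self_sqrt hkpos.le
  obtain ⟨T, hTc, hTtop, hTmax⟩ := exists_top_set h (min_le_right k n)
  have hTk : T.card ≤ k := hTc.le.trans (min_le_left _ _)
  have hcone := sum_compl_le_of_l1Norm_le hgood.2 hxk hTmax
  rw [← hh, ← hσ] at hcone
  set s := ∑ i ∈ T, |h i| with hs
  have hs0 : 0 ≤ s := Finset.sum_nonneg fun i _ => abs_nonneg _
  -- One number bounding both the entries off `T` (at most the average `s / k`) and `1 / k` times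
  -- their `ℓ₁` norm (by the cone condition).
  set α := (s + 2 * σ) / k with hα
  have hα0 : 0 ≤ α := by positivity
  have hkα : k * α = s + 2 * σ := by rw [hα]; field_simp
  have hflat : ∀ j ∉ T, |h j| ≤ α := by
    intro j hj
    have hTk' : T.card = k := by
      have : T.card < n := by
        have := Finset.card_lt_univ_of_notMem hj
        simpa using this
      omega
    have : T.card • |h j| ≤ s := Finset.card_nsmul_le_sum _ _ _ fun i hi => hTtop i hi j hj
    rw [hTk', nsmul_eq_mul] at this
    rw [hα, le_div_iff₀ hkpos]
    linarith
  set a := mask T h with ha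
  set b := mask Tᶜ h with hb
  have hab : h = a + b := by
    ext i
    by_cases hi : i ∈ T <;> simp [ha, hb, mask_apply, hi]
  have ha1 : s ≤ √k * ‖a‖ := by
    have h1 : s ^ 2 ≤ k * ‖a‖ ^ 2 := by
      have h2 : s ^ 2 ≤ T.card * ∑ i ∈ T, |h i| ^ 2 := sq_sum_le_card_mul_sum_sq
      have h3 : ∑ i ∈ T, |h i| ^ 2 = ‖a‖ ^ 2 := by
        rw [ha, norm_mask_sq]
        simp [Finset.sum_ite_mem]
      rw [h3] at h2
      exact h2.trans (mul_le_mul_of_nonneg_right (by exact_mod_cast hTk) (sq_nonneg _))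
    refine le_of_sq_le_sq ?_ (by positivity)
    rw [mul_pow, Real.sq_sqrt hkpos.le]
    exact h1
  set t := σ / √k with ht
  have ht0 : 0 ≤ t := by positivity
  have hσt : σ = √k * t := by rw [ht]; field_simp
  have hR : √k * α ≤ ‖a‖ + 2 * t := by
    refine le_of_mul_le_mul_left ?_ hsk
    rw [← mul_assoc, hskk, hkα, hσt]
    linarith
  have hbn : ‖b‖ ≤ √k * α := by
    refine le_of_sq_le_sq ?_ (by positivity)
    rw [hb, norm_mask_sq, mul_pow, Real.sq_sqrt hkpos.le]
    calc ∑ i, (if i ∈ Tᶜ then (1 : ℝ) else 0) * h i ^ 2 = ∑ i ∈ Tᶜ, |h i| * |h i| := by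
          simp only [ite_mul, one_mul, zero_mul, Finset.sum_ite_mem, Finset.univ_inter,
            abs_mul_abs_self, sq]
      _ ≤ ∑ i ∈ Tᶜ, α * |h i| := Finset.sum_le_sum fun i hi =>
          mul_le_mul_of_nonneg_right (hflat i (Finset.mem_compl.mp hi)) (abs_nonneg _)
      _ = α * ∑ i ∈ Tᶜ, |h i| := by rw [Finset.mul_sum]
      _ ≤ α * (k * α) := mul_le_mul_of_nonneg_left (hcone.trans hkα.ge) hα0
      _ = k * α ^ 2 := by ring
  have hinner := hO.abs_inner_mask_compl_le hθ h hTk hα0 hflat (hcone.trans hkα.ge)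
  rw [← ha, ← hb] at hinner
  have hAh : ‖A.toEuclideanLin h‖ ≤ 2 * ε := by
    have h1 : A.toEuclideanLin h =
        -(A.toEuclideanLin x' - (A.toEuclideanLin x₀ + z)) - z := by
      rw [hh, map_sub]; abel
    rw [h1]
    refine (norm_sub_le _ _).trans ?_
    rw [norm_neg]
    linarith [hgood.1]
  have haI := hI a ((nnzCount_mask_le T h).trans hTk)
  have hAa : ‖A.toEuclideanLin a‖ ≤ 2 * ‖a‖ := by
    refine le_of_sq_le_sq ?_ (by positivity)
    nlinarith [haI.2, sq_nonneg ‖a‖]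
  have hexp : ‖A.toEuclideanLin a‖ ^ 2 =
      inner ℝ (A.toEuclideanLin h) (A.toEuclideanLin a) -
        inner ℝ (A.toEuclideanLin b) (A.toEuclideanLin a) := by
    rw [hab, map_add, inner_add_left, add_sub_cancel_right, real_inner_self_eq_norm_sq]
  have hCS : inner ℝ (A.toEuclideanLin h) (A.toEuclideanLin a) ≤ 2 * ε * (2 * ‖a‖) :=
    (real_inner_le_norm _ _).trans (mul_le_mul hAh hAa (norm_nonneg _) (by positivity))
  -- From `(1 - δ - θ)‖a‖ ≤ 4ε + 2θt` with `1 - δ - θ ≥ 0.04` and `θ ≤ 1`. Both conclusions then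
  -- follow from `‖b‖ ≤ ‖a‖ + 2t` and its `ℓ₁` analogue.
  have hanorm : ‖a‖ ≤ 100 * ε + 50 * t := by
    rcases (norm_nonneg a).eq_or_lt with h0 | hpos
    · rw [← h0]; positivity
    · have h1 : (1 - δ) * ‖a‖ ^ 2 ≤ 2 * ε * (2 * ‖a‖) + θ * ‖a‖ * (‖a‖ + 2 * t) := by
        have h2 := (abs_le.mp hinner).1
        have h3 : θ * ‖a‖ * (√k * α) ≤ θ * ‖a‖ * (‖a‖ + 2 * t) :=
          mul_le_mul_of_nonneg_left hR (by positivity)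
        linarith [haI.1]
      have h2 : (1 - δ) * ‖a‖ ≤ 4 * ε + θ * (‖a‖ + 2 * t) := by
        refine le_of_mul_le_mul_right ?_ hpos
        nlinarith
      have h3 : θ * t ≤ 1 * t := mul_le_mul_of_nonneg_right (by linarith) ht0
      have h4 : (δ + θ) * ‖a‖ ≤ 0.96 * ‖a‖ := mul_le_mul_of_nonneg_right hδθ hpos.le
      linarith
  constructor
  · have h1 : 102 / √k * σ = 102 * t := by rw [ht]; ring
    have h2 : ‖h‖ ≤ ‖a‖ + ‖b‖ := by rw [hab]; exact norm_add_le a b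
    rw [h1]
    linarith
  · have h1 : l1Norm h = s + ∑ i ∈ Tᶜ, |h i| := (Finset.sum_add_sum_compl T _).symm
    have h2 : √k * ‖a‖ ≤ √k * (100 * ε + 50 * t) := mul_le_mul_of_nonneg_left hanorm hsk.le
    have h3 : √k * (100 * ε + 50 * t) = 100 * √k * ε + 50 * σ := by rw [hσt]; ring
    linarith

/-- If `δ_k < 0.307` with `k ≥ 2`, or `δ_{2k} < 0.472`, then `δ_k + θ_{k,k} ≤ 0.96`. -/
theorem exists_isometryBound_orthoBound {m n k : ℕ} {A : Matrix (Fin m) (Fin n) ℝ}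
    (h : (2 ≤ k ∧ vecRIC A k < 0.307) ∨ vecRIC A (2 * k) < 0.472) :
    ∃ δ θ : ℝ, 0 ≤ δ ∧ 0 ≤ θ ∧ δ + θ ≤ 0.96 ∧ IsometryBound A k δ ∧ OrthoBound A k k θ := by
  rcases h with ⟨hk, h⟩ | h
  · have hI := isometryBound_of_vecRIC_lt h
    set p := k / 2 with hp
    set q := k - k / 2 with hq
    have hO : OrthoBound A p q 0.307 := hI.orthoBound (by omega)
    have hO2 := (hO.enlarge (by norm_num) (by omega : 0 < p) (by omega : p ≤ k)).symm.enlarge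
      (by positivity) (by omega : 0 < q) (by omega : q ≤ k)
    refine ⟨0.307, _, by norm_num, by positivity, ?_, hI, hO2⟩
    -- Splitting `k` into halves costs the factor `√(k² / (pq)) ≤ √4.5 < 2.122`, with equality in
    -- the first bound at `k = 3`; and `0.307 (1 + 2.122) < 0.96`.
    have hpq : 2 * (k * k) ≤ 9 * (q * p) := by
      obtain h1 | h1 : q = p ∨ q = p + 1 := by omega
      · have h2 : k = p + p := by omega
        rw [h1, h2]
        nlinarith
      · have h2 : k = p + p + 1 := by omega
        have h3 : 1 ≤ p := by omega
        rw [h1, h2]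
        nlinarith
    have hpq' : 2 * ((k : ℝ) * k) ≤ 9 * (q * p) := by exact_mod_cast hpq
    have hp0 : (0 : ℝ) < p := by exact_mod_cast (by omega : 0 < p)
    have hq0 : (0 : ℝ) < q := by exact_mod_cast (by omega : 0 < q)
    have hsqrt : √((k : ℝ) / q) * √((k : ℝ) / p) ≤ 2.122 := by
      rw [← Real.sqrt_mul (by positivity), div_mul_div_comm]
      refine Real.sqrt_le_iff.mpr ⟨by norm_num, ?_⟩
      rw [div_le_iff₀ (by positivity)]
      nlinarith [mul_pos hq0 hp0]
    rw [← mul_assoc]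
    nlinarith
  · have hI := isometryBound_of_vecRIC_lt h
    exact ⟨0.472, 0.472, by norm_num, by norm_num, by norm_num,
      fun x hx => hI x (by omega), hI.orthoBound (by omega)⟩

/-- The RIP inequality `δ_k ≤ c`. -/
def ricInequality (k : ℕ) (c : ℝ) (hc : 0 ≤ c) : RIPInequality where
  p := 1
  q := 0
  ricIndex := fun _ => k
  rocIndex := Fin.elim0
  f := fun δ _ => δ 0
  c := c
  mono := fun _ _ _ _ _ h _ _ => h 0
  map_zero := rfl
  c_nonneg := hc

theorem opRIC_nonneg {m n₁ n₂ : ℕ} (𝒜 : MeasOp m n₁ n₂) (k : ℕ) : 0 ≤ opRIC 𝒜 k :=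
  Real.sInf_nonneg fun _ h => h.1

/-- Robust recovery of matrices for operators with small restricted isometry constants. -/
theorem mat_robust {m n₁ n₂ k : ℕ} (hn : n₁ ≤ n₂) (hk : 1 ≤ k) {𝒜 : MeasOp m n₁ n₂}
    (h : (2 ≤ k ∧ opRIC 𝒜 k < 0.307) ∨ opRIC 𝒜 (2 * k) < 0.472) :
    (∀ ε : ℝ, MatFrobRobust 𝒜 k ε 102 200) ∧ MatNuclearRobust 𝒜 k 0 102 := by
  -- An RIP inequality is not strict, so the threshold is the operator's own constant, which lies
  -- strictly below the required bound.
  obtain ⟨F, hF, hFv⟩ : ∃ F : Set RIPInequality, OpSatisfies F 𝒜 ∧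
      ∀ A : Matrix (Fin m) (Fin n₁) ℝ, VecSatisfies F A →
        (2 ≤ k ∧ vecRIC A k < 0.307) ∨ vecRIC A (2 * k) < 0.472 := by
    rcases h with ⟨hk2, h⟩ | h
    · refine ⟨{ricInequality k _ (opRIC_nonneg 𝒜 k)}, ?_, fun A hA =>
        Or.inl ⟨hk2, lt_of_le_of_lt (hA _ rfl) h⟩⟩
      rintro _ rfl
      exact le_rfl
    · refine ⟨{ricInequality (2 * k) _ (opRIC_nonneg 𝒜 (2 * k))}, ?_, fun A hA =>
        Or.inr (lt_of_le_of_lt (hA _ rfl) h)⟩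
      rintro _ rfl
      exact le_rfl
  refine ⟨fun ε => matFrobRobust_of_vecL2Robust hn (fun A hA => ?_) hF,
    matNuclearRobust_of_vecL1Robust hn (fun A hA => ?_) hF⟩
  · obtain ⟨δ, θ, hδ, hθ, hδθ, hI, hO⟩ := exists_isometryBound_orthoBound (hFv A hA)
    exact fun x₀ x' xk z hz hg hxk => (error_bounds hk hδ hθ hδθ hI hO hz hg hxk).1
  · obtain ⟨δ, θ, hδ, hθ, hδθ, hI, hO⟩ := exists_isometryBound_orthoBound (hFv A hA)
    intro x₀ x' xk z hz hg hxk
    simpa using (error_bounds hk hδ hθ hδθ hI hO hz hg hxk).2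

end LowRank

theorem mainTheorem3 :
    (∀ (m n₁ n₂ k : ℕ), n₁ ≤ n₂ → 1 ≤ k → ∀ (F : Set RIPInequality) (ε C₁ C₂ C₃ : ℝ),
      ((∀ A : Matrix (Fin m) (Fin n₁) ℝ, VecSatisfies F A → VecL2Robust A k ε C₁ C₂) →
        ∀ 𝒜 : MeasOp m n₁ n₂, OpSatisfies F 𝒜 → MatFrobRobust 𝒜 k ε C₁ C₂) ∧
      ((∀ A : Matrix (Fin m) (Fin n₁) ℝ, VecSatisfies F A → VecL1Robust A k ε C₃) →
        ∀ 𝒜 : MeasOp m n₁ n₂, OpSatisfies F 𝒜 → MatNuclearRobust 𝒜 k ε C₃)) ∧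
    (∃ C₁ C₂ C₃ : ℝ, 0 < C₁ ∧ 0 < C₂ ∧ 0 < C₃ ∧
      ∀ (m n₁ n₂ k : ℕ), n₁ ≤ n₂ → 1 ≤ k → ∀ 𝒜 : MeasOp m n₁ n₂,
        ((2 ≤ k ∧ opRIC 𝒜 k < 0.307) ∨ opRIC 𝒜 (2 * k) < 0.472) →
          (∀ ε : ℝ, MatFrobRobust 𝒜 k ε C₁ C₂) ∧ MatNuclearRobust 𝒜 k 0 C₃) :=
  ⟨fun _ _ _ _ hn _ _ _ _ _ _ => ⟨fun h _ hF => matFrobRobust_of_vecL2Robust hn h hF,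
      fun h _ hF => matNuclearRobust_of_vecL1Robust hn h hF⟩,
    102, 200, 102, by norm_num, by norm_num, by norm_num,
    fun _ _ _ _ hn hk _ h => mat_robust hn hk h⟩
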